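/- Let $n\ge 1$ and, for $i=1,\dots,n-1$, let $r_i,t_i\ge 0$ be integers. Consider the problem $$\min\ g(v_1,\dots,v_n)\quad\text{s.t.}\quad v_i\le f^i_j(v_{i+1})\ (1\le i\le n-1,\ 1\le j\le r_i),\quad v_{i+1}\le b^i_k(v_i)\ (1\le i\le n-1,\ 1\le k\le t_i),\quad 0\le v_i\le u_i\ (1\le i\le n),\tag{P}$$ where $u_i\ge 0$, the objective $g$ is non-increasing in the componentwise order on $\mathbb R^n_{\ge0}$, and all functions $f^i_j$, $b^i_k$ are concave and (strictly) increasing on $[0,\infty)$ and positive at $0$. Assume that all $f^i_j$ and $b^i_k$ are linear, i.e. of the form $x\mapsto \alpha x+\gamma$. The input of (P) consists of the slopes and constant terms of the $f^i_j$ and $b^i_k$ and of the numbers $u_i$. The forward-backward algorithm sets $\bar u=u$; then (forward phase) for $i=1,\dots,n-1$ it replaces $(\bar u_i,\bar u_{i+1})$ by the optimal solution of the linear program $$\max\ v_i+v_{i+1}\quad\text{s.t.}\quad v_i\le f^i_j(v_{i+1})\ (j\le r_i),\quad v_{i+1}\le b^i_k(v_i)\ (k\le t_i),\quad 0\le v_i\le\bar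 u_i,\quad 0\le v_{i+1}\le\bar u_{i+1},$$ computed by Megiddo's prune-and-search algorithm for linear programs in two variables (with linear-time median selection); then (backward phase) for $i=n-1,\dots,1$ it replaces $\bar u_i$ by $\min\{\bar u_i,\min_{j\le r_i} f^i_j(\bar u_{i+1})\}$; it returns $\bar u$. Time is the number of elementary steps: reading one input number, producing an integer constant, one arithmetic operation ($+,-,\times,/$) or one comparison of two real numbers, one step of list, array or loop handling. **Theorem.** 1. For every input as above, the forward-backward algorithm returns an optimal solution of (P), for every non-increasing objective $g$. 2. There is a constant $C$ such that for all $n\ge2$, all $r_i,t_i$ with $t_i+r_i\ge1$ for each $i$, and all inputs as above, the algorithm takes at most $C\sum_{i=1}^{n-1}(t_i+r_i)$ elementary steps. 3. This complexity is optimal: for all $n$, all $r_i,t_i$ and every strictly decreasing objective $g$ (i.e. $v\le w$, $v\ne w$ implies $g(v)>g(w)$), every algorithm that returns an optimal solution of (P) for all inputs of this size takes at least $\sum_{i=1}^{n-1}(t_i+r_i)$ elementary steps on some input of this size, even if it may do anything but reading input numbers free of charge. -/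

import Mathlib

/-! ## The optimization problem -/

namespace SpeedPlanning

/-- The size parameters of a problem with `m + 1` variables: for each pair of consecutive variables
`(v i.castSucc, v i.succ)`, `i : Fin m`, there are `r i` constraints of the first kind and `t i`
constraints of the second kind. -/
structure Shape where
  m : ℕ
  r : Fin m → ℕ
  t : Fin m → ℕ

/-- The total number of functional constraints, `∑ i, (t i + r i)`. -/
def Shape.numConstraints (S : Shape) : ℕ := ∑ i, (S.t i + S.r i)

/-- The constraints `v_i ≤ f_j^i (v_{i+1})`, `v_{i+1} ≤ b_k^i (v_i)` and `0 ≤ v_i ≤ u_i`. -/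
structure Problem (S : Shape) where
  f : (i : Fin S.m) → Fin (S.r i) → ℝ → ℝ
  b : (i : Fin S.m) → Fin (S.t i) → ℝ → ℝ
  u : Fin (S.m + 1) → ℝ

namespace Problem

variable {S : Shape}

def feasible (p : Problem S) : Set (Fin (S.m + 1) → ℝ) :=
  {v | (∀ i j, v i.castSucc ≤ p.f i j (v i.succ)) ∧
       (∀ i k, v i.succ ≤ p.b i k (v i.castSucc)) ∧
       ∀ i, 0 ≤ v i ∧ v i ≤ p.u i}

/-- The standing assumptions on the constraints: on the nonnegative half-line every `f_j^i` and
every `b_k^i` is concave and increasing, they are positive at `0`, and the bounds `u_i` are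
nonnegative. -/
structure Admissible (p : Problem S) : Prop where
  f_concave : ∀ i j, ConcaveOn ℝ (Set.Ici 0) (p.f i j)
  f_increasing : ∀ i j, StrictMonoOn (p.f i j) (Set.Ici 0)
  f_pos : ∀ i j, 0 < p.f i j 0
  b_concave : ∀ i k, ConcaveOn ℝ (Set.Ici 0) (p.b i k)
  b_increasing : ∀ i k, StrictMonoOn (p.b i k) (Set.Ici 0)
  b_pos : ∀ i k, 0 < p.b i k 0
  u_nonneg : ∀ i, 0 ≤ p.u i

/-- `v` is an optimal solution of the problem `min g(v)` over the feasible region. -/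
def IsOptimal (p : Problem S) (g : (Fin (S.m + 1) → ℝ) → ℝ) (v : Fin (S.m + 1) → ℝ) : Prop :=
  v ∈ p.feasible ∧ ∀ w ∈ p.feasible, g v ≤ g w

end Problem

/-- The numbers that make up the input of a problem with linear (that is, affine) constraint
functions: slope and constant term of each `f_j^i` and each `b_k^i`, and the bounds `u_i`. -/
inductive Addr (S : Shape) : Type
  | fSlope (i : Fin S.m) (j : Fin (S.r i))
  | fConst (i : Fin S.m) (j : Fin (S.r i))
  | bSlope (i : Fin S.m) (k : Fin (S.t i))
  | bConst (i : Fin S.m) (k : Fin (S.t i))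
  | u (i : Fin (S.m + 1))

/-- The problem with linear constraint functions whose coefficients are the input `d`. -/
def linearProblem {S : Shape} (d : Addr S → ℝ) : Problem S where
  f i j x := d (.fSlope i j) * x + d (.fConst i j)
  b i k x := d (.bSlope i k) * x + d (.bConst i k)
  u i := d (.u i)

/-! ## The model of computation -/

inductive ArithOp : Type
  | add | sub | mul | div

def ArithOp.eval {K : Type} [Field K] : ArithOp → K → K → K
  | .add, x, y => x + y
  | .sub, x, y => x - y
  | .mul, x, y => x * y
  | .div, x, y => x / y

/-- Computations with unit cost operations on numbers. The numbers are elements of `ρ`, the input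
consists of one number at each address in `ι`, and the result is an element of `α`. Elementary
steps: read one input number, produce an integer constant, one arithmetic operation, one comparison
of two numbers, or (`tick`) one step of bookkeeping: a list cell, an array access, a loop
iteration. An algorithm that is defined uniformly for an arbitrary type `ρ` of numbers has access
to the numbers only through these steps. The elements of `Comp ι ℝ α` are more general: what they do
next may depend in any way on the real numbers that they have read, so that a lower bound for all
of them holds a fortiori for real RAM programs and for algebraic computation trees. -/
inductive Comp (ι ρ α : Type) : Type
  | ret (a : α)
  | tick (k : Comp ι ρ α)
  | read (i : ι) (k : ρ → Comp ι ρ α)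
  | const (q : ℤ) (k : ρ → Comp ι ρ α)
  | arith (o : ArithOp) (x y : ρ) (k : ρ → Comp ι ρ α)
  | less (x y : ρ) (k : Bool → Comp ι ρ α)

namespace Comp

/-- Sequential composition. -/
def bind {ι ρ α β : Type} : Comp ι ρ α → (α → Comp ι ρ β) → Comp ι ρ β
  | ret a, h => h a
  | tick k, h => tick (k.bind h)
  | read i k, h => read i fun x => (k x).bind h
  | const q k, h => const q fun x => (k x).bind h
  | arith o x y k, h => arith o x y fun z => (k z).bind h
  | less x y k, h => less x y fun c => (k c).bind h

instance {ι ρ : Type} : Monad (Comp ι ρ) where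
  pure := ret
  bind := bind

section Semantics

variable {ι K α : Type} [Field K] [LinearOrder K]

/-- The result of a computation on the input `d`. -/
def output (d : ι → K) : Comp ι K α → α
  | ret a => a
  | tick k => k.output d
  | read i k => (k (d i)).output d
  | const q k => (k (q : K)).output d
  | arith o x y k => (k (o.eval x y)).output d
  | less x y k => (k (decide (x < y))).output d

/-- The number of elementary steps of a computation on the input `d`. -/
def steps (d : ι → K) : Comp ι K α → ℕ
  | ret _ => 0
  | tick k => k.steps d + 1
  | read i k => (k (d i)).steps d + 1
  | const q k => (k (q : K)).steps d + 1
  | arith o x y k => (k (o.eval x y)).steps d + 1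
  | less x y k => (k (decide (x < y))).steps d + 1

end Semantics

end Comp

variable {ι ρ : Type}

/-! Single steps as commands. -/

def step : Comp ι ρ Unit := .tick (.ret ())
def input (i : ι) : Comp ι ρ ρ := .read i .ret
def number (q : ℤ) : Comp ι ρ ρ := .const q .ret
def add (x y : ρ) : Comp ι ρ ρ := .arith .add x y .ret
def sub (x y : ρ) : Comp ι ρ ρ := .arith .sub x y .ret
def mul (x y : ρ) : Comp ι ρ ρ := .arith .mul x y .ret
def div (x y : ρ) : Comp ι ρ ρ := .arith .div x y .ret
def lt (x y : ρ) : Comp ι ρ Bool := .less x y .ret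

/-- Run `body` for the entries of a list in turn, at the price of one step per iteration on top of
the cost of `body`. -/
def forEach {σ β : Type} : List β → σ → (σ → β → Comp ι ρ σ) → Comp ι ρ σ
  | [], s, _ => return s
  | x :: xs, s, body => do
    step
    forEach xs (← body s x) body

/-- The assignment `a[i] := x` in an array. -/
def store {n : ℕ} (a : Fin n → ρ) (i : Fin n) (x : ρ) : Comp ι ρ (Fin n → ρ) := do
  step
  return Function.update a i x

def listLength {β : Type} : List β → Comp ι ρ ℕ
  | [] => return 0
  | _ :: xs => do
    step
    return (← listLength xs) + 1

/-! ## Selection of the `k`-th smallest entry of a list in linear time (median of medians)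

The recursion is bounded by a counter `fuel`, which is no part of the computation; the length of
the list is always large enough. -/

/-- Insert `x` into a sorted list. -/
def insertSorted (x : ρ) : List ρ → Comp ι ρ (List ρ)
  | [] => do
    step
    return [x]
  | y :: ys => do
    step
    if ← lt x y then
      return x :: y :: ys
    else
      return y :: (← insertSorted x ys)

def insertionSort : List ρ → Comp ι ρ (List ρ)
  | [] => return []
  | x :: xs => do
    step
    insertSorted x (← insertionSort xs)

/-- The medians of the consecutive groups of five entries. -/
def fiveMedians : List ρ → Comp ι ρ (List ρ)
  | x₁ :: x₂ :: x₃ :: x₄ :: x₅ :: xs => do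
    step
    let s ← insertionSort [x₁, x₂, x₃, x₄, x₅]
    return s.getD 2 x₁ :: (← fiveMedians xs)
  | _ => return []

/-- Split a list into the entries that are smaller than `p`, equal to `p`, and larger than `p`. -/
def split3 (p : ρ) : List ρ → Comp ι ρ (List ρ × List ρ × List ρ)
  | [] => return ([], [], [])
  | x :: xs => do
    step
    let (small, equal, large) ← split3 p xs
    if ← lt x p then
      return (x :: small, equal, large)
    else if ← lt p x then
      return (small, equal, x :: large)
    else
      return (small, x :: equal, large)

/-- The entry of rank `k` (counted from `0`) of the list `xs`; `x₀` is returned if there is none. -/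
def select : (fuel : ℕ) → (x₀ : ρ) → (k : ℕ) → (xs : List ρ) → Comp ι ρ ρ
  | 0, x₀, _, _ => return x₀
  | fuel + 1, x₀, k, xs => do
    let n ← listLength xs
    if n < 5 then
      return (← insertionSort xs).getD k x₀
    else
      let p ← select fuel x₀ (n / 5 / 2) (← fiveMedians xs)
      let (small, equal, large) ← split3 p xs
      let a ← listLength small
      let c ← listLength equal
      if k < a then
        select fuel x₀ k small
      else if k < a + c then
        return p
      else
        select fuel x₀ (k - a - c) large

/-! ## Megiddo's algorithm for linear programs in two variables

The program is in the normal form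
`min y` subject to `y ≥ ℓ(x)` for the lines `ℓ` in a list `lower`, `y ≤ ℓ(x)` for the lines `ℓ` in a
list `upper`, and `lo ≤ x ≤ hi`. In the auxiliary procedures, `isMax` is `true` for the list `lower`,
of which the upper envelope (maximum) matters, and `false` for the list `upper`, of which the
lower envelope (minimum) matters. -/

/-- The line `x ↦ slope * x + icept`. -/
structure Line (ρ : Type) : Type where
  slope : ρ
  icept : ρ

def Line.at (l : Line ρ) (x : ρ) : Comp ι ρ ρ := do
  add (← mul l.slope x) l.icept

/-- Two lines, the slope of `flat` being smaller than that of `steep`, that meet at the abscissa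
`pos`. -/
structure Crossing (ρ : Type) : Type where
  pos : ρ
  flat : Line ρ
  steep : Line ρ

def crossing (flat steep : Line ρ) : Comp ι ρ (Crossing ρ) := do
  let x ← div (← sub flat.icept steep.icept) (← sub steep.slope flat.slope)
  return ⟨x, flat, steep⟩

/-- `x > y` if `isMax` is true and `x < y` otherwise. -/
def beats (isMax : Bool) (x y : ρ) : Comp ι ρ Bool :=
  if isMax then lt y x else lt x y

/-- If the two lines do not cross in the interior of `[lo, hi]`, the one that is not redundant
there. -/
def resolve (isMax : Bool) (lo hi : ρ) (c : Crossing ρ) : Comp ι ρ (Option (Line ρ)) := do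
  if ← lt lo c.pos then
    if ← lt c.pos hi then
      return none
    else
      return some (if isMax then c.flat else c.steep)
  else
    return some (if isMax then c.steep else c.flat)

/-- Group the lines into pairs. A pair that does not cross in the interior of `[lo, hi]` is replaced
by one of its lines. Returned are the lines that are kept and the crossings of the other pairs. -/
def pairUp (isMax : Bool) (lo hi : ρ) :
    List (Line ρ) → Comp ι ρ (List (Line ρ) × List (Crossing ρ))
  | l₁ :: l₂ :: ls => do
    step
    let (kept, crossings) ← pairUp isMax lo hi ls
    if ← lt l₁.slope l₂.slope then
      let c ← crossing l₁ l₂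
      match ← resolve isMax lo hi c with
      | some l => return (l :: kept, crossings)
      | none => return (kept, c :: crossings)
    else if ← lt l₂.slope l₁.slope then
      let c ← crossing l₂ l₁
      match ← resolve isMax lo hi c with
      | some l => return (l :: kept, crossings)
      | none => return (kept, c :: crossings)
    else if ← beats isMax l₁.icept l₂.icept then
      return (l₁ :: kept, crossings)
    else
      return (l₂ :: kept, crossings)
  | ls => return (ls, [])

/-- After `[lo, hi]` has shrunk, drop one line of each pair that does not cross in its interior any
more; the remaining lines are put in front of `kept`. -/
def prune (isMax : Bool) (lo hi : ρ) (kept : List (Line ρ)) :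
    List (Crossing ρ) → Comp ι ρ (List (Line ρ))
  | [] => return kept
  | c :: cs => do
    step
    let ls ← prune isMax lo hi kept cs
    match ← resolve isMax lo hi c with
    | some l => return l :: ls
    | none => return c.flat :: c.steep :: ls

/-- The abscissae of the crossings in two lists. -/
def positions : List (Crossing ρ) → List (Crossing ρ) → Comp ι ρ (List ρ)
  | [], [] => return []
  | [], c :: cs => do
    step
    return c.pos :: (← positions [] cs)
  | c :: cs, ds => do
    step
    return c.pos :: (← positions cs ds)

/-- The value of an envelope at a point, with its one-sided derivatives there. -/
structure Germ (ρ : Type) : Type where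
  val : ρ
  left : ρ
  right : ρ

/-- The germ at `x` of the maximum (or minimum) of a list of lines; `none` for the empty list. -/
def envelope (isMax : Bool) (x : ρ) : List (Line ρ) → Comp ι ρ (Option (Germ ρ))
  | [] => return none
  | l :: ls => do
    step
    let y ← l.at x
    match ← envelope isMax x ls with
    | none => return some ⟨y, l.slope, l.slope⟩
    | some e =>
      if ← beats isMax y e.val then
        return some ⟨y, l.slope, l.slope⟩
      else if ← beats isMax e.val y then
        return some e
      else
        let left := if ← beats isMax e.left l.slope then l.slope else e.left
        let right := if ← beats isMax l.slope e.right then l.slope else e.right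
        return some ⟨e.val, left, right⟩

/-- Where the optimal solutions are, relative to a tested abscissa. -/
inductive Verdict : Type
  | goLeft | goRight | optimal | infeasible

/-- The verdict on an abscissa where the envelope of the lines in `lower` has the germ `g` and that
of the lines in `upper` has the germ `h` (if there are any). -/
def judge (g : Germ ρ) : Option (Germ ρ) → Comp ι ρ Verdict
  | none => do
    let zero ← number 0
    if ← lt g.right zero then return .goRight
    else if ← lt zero g.left then return .goLeft
    else return .optimal
  | some h => do
    if ← lt h.val g.val then
      if ← lt g.right h.right then return .goRight
      else if ← lt h.left g.left then return .goLeft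
      else return .infeasible
    else
      let zero ← number 0
      let slack ← lt g.val h.val
      let leavesRight ← lt h.right g.right
      let leavesLeft ← lt g.left h.left
      let improvesRight ← lt g.right zero
      let improvesLeft ← lt zero g.left
      if improvesRight && (slack || !leavesRight) then return .goRight
      else if improvesLeft && (slack || !leavesLeft) then return .goLeft
      else return .optimal

/-- Minimize `l` on `[lo, hi]`. -/
def minimizeLine (l : Line ρ) (lo hi : ρ) : Comp ι ρ (Option (ρ × ρ)) := do
  if ← lt hi lo then
    return none
  else
    let x := if ← lt l.slope (← number 0) then hi else lo
    return some (x, ← l.at x)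

/-- The linear program with one line in `lower` and one line in `upper`. -/
def solveTwo (l h : Line ρ) (lo hi : ρ) : Comp ι ρ (Option (ρ × ρ)) := do
  if ← lt l.slope h.slope then
    let c ← crossing l h
    minimizeLine l (if ← lt lo c.pos then c.pos else lo) hi
  else if ← lt h.slope l.slope then
    let c ← crossing h l
    minimizeLine l lo (if ← lt c.pos hi then c.pos else hi)
  else if ← lt h.icept l.icept then
    return none
  else
    minimizeLine l lo hi

/-- Megiddo's prune-and-search algorithm. Each round pairs up the lines of either list, tests the
median of the crossings, and drops one line of each pair whose crossing is not in the interior of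
the remaining interval. The result is an optimal solution `(x, y)`, or `none` if there is none. As
every round drops a line, at most `fuel = lower.length + upper.length` rounds take place; `fuel`
is no part of the computation. -/
def megiddoLoop : (fuel : ℕ) → (lower upper : List (Line ρ)) → (lo hi : ρ) →
    Comp ι ρ (Option (ρ × ρ))
  | 0, _, _, _, _ => return none
  | _ + 1, [], _, _, _ => return none
  | _ + 1, [l], [], lo, hi => minimizeLine l lo hi
  | _ + 1, [l], [h], lo, hi => solveTwo l h lo hi
  | fuel + 1, lower, upper, lo, hi => do
    let (kept₁, crossings₁) ← pairUp true lo hi lower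
    let (kept₂, crossings₂) ← pairUp false lo hi upper
    match ← positions crossings₁ crossings₂ with
    | [] => megiddoLoop fuel kept₁ kept₂ lo hi
    | x₀ :: xs =>
      let n ← listLength (x₀ :: xs)
      let x ← select n x₀ (n / 2) (x₀ :: xs)
      match ← envelope true x lower with
      | none => return none
      | some g =>
        match ← judge g (← envelope false x upper) with
        | .infeasible => return none
        | .optimal => return some (x, g.val)
        | .goLeft =>
          let lower' ← prune true lo x kept₁ crossings₁
          let upper' ← prune false lo x kept₂ crossings₂
          megiddoLoop fuel lower' upper' lo x
        | .goRight =>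
          let lower' ← prune true x hi kept₁ crossings₁
          let upper' ← prune false x hi kept₂ crossings₂
          megiddoLoop fuel lower' upper' x hi

def megiddo (lower upper : List (Line ρ)) (lo hi : ρ) : Comp ι ρ (Option (ρ × ρ)) :=
  megiddoLoop (lower.length + upper.length) lower upper lo hi

/-! ## The forward-backward algorithm -/

section ForwardBackward

variable (S : Shape)

/-- The optimal solution `(v, w)`, computed by Megiddo's algorithm, of the linear program
`max v + w` subject to `v ≤ f_j^i (w)`, `w ≤ b_k^i (v)`, `0 ≤ v ≤ ū_i`, `0 ≤ w ≤ ū_{i+1}`.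
In the variables `x = v`, `y = -(v + w)`, with `f_j^i (w) = α w + γ` and `b_k^i (v) = β v + δ`, these
constraints are `y ≤ -((1 + α) / α) x + γ / α`, `y ≥ -(1 + β) x - δ`, `0 ≤ x ≤ ū_i`, `y ≤ -x` and
`y ≥ -x - ū_{i+1}`. -/
def solveSubproblem (i : Fin S.m) (uᵢ uᵢ₁ : ρ) : Comp (Addr S) ρ (Option (ρ × ρ)) := do
  let zero ← number 0
  let one ← number 1
  let minusOne ← number (-1)
  let lower ← forEach (List.finRange (S.t i)) [Line.mk minusOne (← sub zero uᵢ₁)] fun ls k => do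
    let β ← input (.bSlope i k)
    let δ ← input (.bConst i k)
    return Line.mk (← sub minusOne β) (← sub zero δ) :: ls
  let upper ← forEach (List.finRange (S.r i)) [Line.mk minusOne zero] fun ls j => do
    let α ← input (.fSlope i j)
    let γ ← input (.fConst i j)
    return Line.mk (← sub zero (← div (← add one α) α)) (← div γ α) :: ls
  match ← megiddo lower upper zero uᵢ with
  | none => return none
  | some (x, y) => return some (x, ← sub (← sub zero y) x)

/-- One step of the forward phase. (The subproblem always has an optimal solution.) -/
def forwardStep (ubar : Fin (S.m + 1) → ρ) (i : Fin S.m) : Comp (Addr S) ρ (Fin (S.m + 1) → ρ) := do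
  match ← solveSubproblem S i (ubar i.castSucc) (ubar i.succ) with
  | none => return ubar
  | some (v, w) =>
    let ubar' ← store ubar i.castSucc v
    store ubar' i.succ w

/-- One step of the backward phase: `ū_i := min {B_i (ū_{i+1}), ū_i}`, `B_i = min_j f_j^i`. -/
def backwardStep (ubar : Fin (S.m + 1) → ρ) (i : Fin S.m) :
    Comp (Addr S) ρ (Fin (S.m + 1) → ρ) := do
  let v ← forEach (List.finRange (S.r i)) (ubar i.castSucc) fun v j => do
    let α ← input (.fSlope i j)
    let γ ← input (.fConst i j)
    let x ← Line.at ⟨α, γ⟩ (ubar i.succ)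
    if ← lt x v then return x else return v
  store ubar i.castSucc v

/-- The forward-backward algorithm, with Megiddo's algorithm for the subproblems of the forward
phase. -/
def forwardBackward : Comp (Addr S) ρ (Fin (S.m + 1) → ρ) := do
  let zero ← number 0
  let zeros : Fin (S.m + 1) → ρ := fun _ => zero
  let u ← forEach (List.finRange (S.m + 1)) zeros fun a i => do
    let x ← input (.u i)
    store a i x
  let ubar ← forEach (List.finRange S.m) u (forwardStep S)
  forEach (List.finRange S.m).reverse ubar (backwardStep S)

end ForwardBackward

end SpeedPlanning

/-! The constraint functions are increasing, so the feasible vectors are closed under componentwise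
maxima, and a greatest feasible vector minimizes every non-increasing objective. The
forward-backward algorithm finds it. Both phases only ever decrease the vector `ū`, and never below
a feasible vector. In the forward phase, the optimal solution of the subproblem for the pair
`(i, i + 1)` is the greatest feasible pair, so that afterwards `ū_{i+1} ≤ b (ū_i)`; moreover
`b ∘ f` is concave and lies above the identity at `0` and at `ū_{i+1}`, hence on `[0, ū_{i+1}]`.
Therefore the constraints of the second kind survive when `ū_{i+1}` decreases to `x` and `ū_i` to the
minimum of `ū_i` and the `f (x)` (`Persists`, `Problem.Admissible.le_comp`), which is what the
backward phase does.

Megiddo's algorithm is correct because the feasible ordinates over a point are bounded by two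
envelopes, one convex and one concave. The germs of the envelopes at a tested abscissa `x` give
lines that bound the feasible set on either side of `x`, and these justify each verdict
(`isValid_output_judge`); a pair of lines that does not cross in the interior of the interval has a
redundant member there (`output_resolve_spec`).

For the running time, the median of the medians of five splits a list of length `n` such that the two
recursive calls of the selection have total length at most `n - n / 18`
(`length_filter_fiveMedians_le`). So selection is linear, and as the median of the crossings is
tested, each round of Megiddo's algorithm drops at least one line out of twelve
(`length_prune_add_length_prune_le`). Both costs are therefore geometric sums.

For the lower bound, all bounds are set to `1` and all constraint functions to `x ↦ x + 1`. The
only optimal solution is the vector of ones. If an algorithm reads neither number of some constraint,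
its output stays the same when that constraint becomes `x ↦ (x + 1) / 4`, which the vector of ones
violates. -/

namespace SpeedPlanning

/-! ### Semantics of computations -/

section Semantics

variable {ι α β σ : Type} (d : ι → ℝ)

namespace Comp

@[simp] lemma output_pure (a : α) : (pure a : Comp ι ℝ α).output d = a := rfl

@[simp] lemma steps_pure (a : α) : (pure a : Comp ι ℝ α).steps d = 0 := rfl

@[simp] lemma output_bind (c : Comp ι ℝ α) (h : α → Comp ι ℝ β) :
    (c >>= h).output d = (h (c.output d)).output d := by
  change (c.bind h).output d = _
  induction c with
  | less x y k ih => exact ih _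
  | _ => simp_all [Comp.bind, output]

@[simp] lemma steps_bind (c : Comp ι ℝ α) (h : α → Comp ι ℝ β) :
    (c >>= h).steps d = c.steps d + (h (c.output d)).steps d := by
  change (c.bind h).steps d = _
  induction c with
  | less x y k ih =>
    have := ih (decide (x < y))
    simp only [Comp.bind, output, steps, this]
    omega
  | _ => simp_all [Comp.bind, output, steps] <;> omega

@[simp] lemma output_ite (p : Prop) [Decidable p] (c₁ c₂ : Comp ι ℝ α) :
    (if p then c₁ else c₂).output d = if p then c₁.output d else c₂.output d := by
  split_ifs <;> rfl

@[simp] lemma steps_ite (p : Prop) [Decidable p] (c₁ c₂ : Comp ι ℝ α) :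
    (if p then c₁ else c₂).steps d = if p then c₁.steps d else c₂.steps d := by
  split_ifs <;> rfl

end Comp

open SpeedPlanning.Comp

@[simp] lemma steps_step : (step : Comp ι ℝ Unit).steps d = 1 := rfl
@[simp] lemma output_input (i : ι) : (input i : Comp ι ℝ ℝ).output d = d i := rfl
@[simp] lemma steps_input (i : ι) : (input i : Comp ι ℝ ℝ).steps d = 1 := rfl
@[simp] lemma output_number (q : ℤ) : (number q : Comp ι ℝ ℝ).output d = q := rfl
@[simp] lemma steps_number (q : ℤ) : (number q : Comp ι ℝ ℝ).steps d = 1 := rfl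
@[simp] lemma output_add (x y : ℝ) : (add x y : Comp ι ℝ ℝ).output d = x + y := rfl
@[simp] lemma steps_add (x y : ℝ) : (add x y : Comp ι ℝ ℝ).steps d = 1 := rfl
@[simp] lemma output_sub (x y : ℝ) : (sub x y : Comp ι ℝ ℝ).output d = x - y := rfl
@[simp] lemma steps_sub (x y : ℝ) : (sub x y : Comp ι ℝ ℝ).steps d = 1 := rfl
@[simp] lemma output_div (x y : ℝ) : (div x y : Comp ι ℝ ℝ).output d = x / y := rfl
@[simp] lemma steps_div (x y : ℝ) : (div x y : Comp ι ℝ ℝ).steps d = 1 := rfl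
@[simp] lemma output_lt (x y : ℝ) : (lt x y : Comp ι ℝ Bool).output d = decide (x < y) := rfl
@[simp] lemma steps_lt (x y : ℝ) : (lt x y : Comp ι ℝ Bool).steps d = 1 := rfl

@[simp] lemma output_store {n : ℕ} (a : Fin n → ℝ) (i : Fin n) (x : ℝ) :
    (store a i x : Comp ι ℝ _).output d = Function.update a i x := rfl

@[simp] lemma steps_store {n : ℕ} (a : Fin n → ℝ) (i : Fin n) (x : ℝ) :
    (store a i x : Comp ι ℝ _).steps d = 1 := rfl

@[simp] lemma output_forEach (l : List β) (s : σ) (body : σ → β → Comp ι ℝ σ) :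
    (forEach l s body).output d = l.foldl (fun s x => (body s x).output d) s := by
  induction l generalizing s <;> simp_all [forEach]

lemma steps_forEach_le (l : List β) (s : σ) (body : σ → β → Comp ι ℝ σ) (c : β → ℕ)
    (h : ∀ s x, (body s x).steps d ≤ c x) :
    (forEach l s body).steps d ≤ (l.map fun x => c x + 1).sum := by
  induction l generalizing s with
  | nil => simp [forEach]
  | cons x xs ih =>
    have h₁ := h s x
    have h₂ := ih ((body s x).output d)
    simp only [forEach, steps_bind, steps_step, List.map_cons, List.sum_cons]
    omega

@[simp] lemma output_listLength (l : List β) :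
    (listLength l : Comp ι ℝ ℕ).output d = l.length := by
  induction l <;> simp_all [listLength]

@[simp] lemma steps_listLength (l : List β) :
    (listLength l : Comp ι ℝ ℕ).steps d = l.length := by
  induction l <;> simp_all [listLength]
  omega

end Semantics

/-! ### Selection in linear time -/

section Selection

variable {ι : Type} (d : ι → ℝ)

open SpeedPlanning.Comp

lemma perm_output_insertSorted (x : ℝ) (l : List ℝ) :
    ((insertSorted x l).output d).Perm (x :: l) := by
  induction l with
  | nil => simp [insertSorted]
  | cons y ys ih =>
    by_cases h : x < y
    · simp [insertSorted, h]
    · simpa [insertSorted, h] using (ih.cons y).trans (List.Perm.swap x y ys)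

lemma pairwise_output_insertSorted (x : ℝ) (l : List ℝ) (hl : l.Pairwise (· ≤ ·)) :
    ((insertSorted x l).output d).Pairwise (· ≤ ·) := by
  induction l with
  | nil => simp [insertSorted]
  | cons y ys ih =>
    rw [List.pairwise_cons] at hl
    by_cases h : x < y
    · simp only [insertSorted, output_bind, output_lt, h, decide_true, if_true,
        output_pure, List.pairwise_cons, List.mem_cons, forall_eq_or_imp]
      exact ⟨⟨h.le, fun z hz => h.le.trans (hl.1 z hz)⟩, hl⟩
    · have hp := perm_output_insertSorted d x ys
      simp only [insertSorted, output_bind, output_lt, h, decide_false,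
        Bool.false_eq_true, if_false, output_pure, List.pairwise_cons]
      refine ⟨fun z hz => ?_, ih hl.2⟩
      rcases List.mem_cons.1 (hp.mem_iff.1 hz) with rfl | hz
      · exact not_lt.1 h
      · exact hl.1 z hz

lemma steps_insertSorted_le (x : ℝ) (l : List ℝ) :
    (insertSorted x l).steps d ≤ 2 * l.length + 1 := by
  induction l with
  | nil => simp [insertSorted]
  | cons y ys ih =>
    simp only [insertSorted, steps_bind, steps_step, steps_lt, steps_ite, List.length_cons]
    split_ifs <;> simp <;> omega

lemma perm_output_insertionSort (l : List ℝ) : ((insertionSort l).output d).Perm l := by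
  induction l with
  | nil => simp [insertionSort]
  | cons x xs ih =>
    simpa [insertionSort] using (perm_output_insertSorted d x _).trans (ih.cons x)

lemma pairwise_output_insertionSort (l : List ℝ) :
    ((insertionSort l).output d).Pairwise (· ≤ ·) := by
  induction l with
  | nil => simp [insertionSort]
  | cons x xs ih => simpa [insertionSort] using pairwise_output_insertSorted d x _ ih

lemma steps_insertionSort_le (l : List ℝ) :
    (insertionSort l).steps d ≤ l.length * (2 * l.length + 2) := by
  induction l with
  | nil => simp [insertionSort]
  | cons x xs ih =>
    have h₁ := steps_insertSorted_le d x ((insertionSort xs).output d)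
    rw [(perm_output_insertionSort d xs).length_eq] at h₁
    simp only [insertionSort, steps_bind, steps_step, List.length_cons]
    nlinarith

/-- `p` is the entry of rank `k` (counted from `0`) in the sorted order of `l`. -/
def HasRank (l : List ℝ) (k : ℕ) (p : ℝ) : Prop :=
  l.countP (· < p) ≤ k ∧ k < l.countP (· ≤ p)

lemma HasRank.mem {l : List ℝ} {k : ℕ} {p : ℝ} (h : HasRank l k p) : p ∈ l := by
  by_contra hp
  have : l.countP (· ≤ p) = l.countP (· < p) := by
    refine List.countP_congr fun x hx => ?_
    have : x ≠ p := by rintro rfl; exact hp hx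
    simp [lt_iff_le_and_ne, this]
  have := h.1.trans_lt h.2
  omega

lemma HasRank.perm {l l' : List ℝ} {k : ℕ} {p : ℝ} (h : HasRank l k p) (hl : l.Perm l') :
    HasRank l' k p := by
  unfold HasRank at *
  rwa [hl.countP_eq, hl.countP_eq] at h

lemma hasRank_getD_of_pairwise {l : List ℝ} (hl : l.Pairwise (· ≤ ·)) {k : ℕ} (hk : k < l.length)
    (x₀ : ℝ) : HasRank l k (l.getD k x₀) := by
  induction l generalizing k with
  | nil => simp at hk
  | cons y ys ih =>
    rw [List.pairwise_cons] at hl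
    cases k with
    | zero =>
      refine ⟨?_, ?_⟩
      · simpa [List.countP_eq_zero] using hl.1
      · simp
    | succ k =>
      have hk' : k < ys.length := by simpa using hk
      have h := ih hl.2 hk'
      have hy := hl.1 _ h.mem
      simp only [List.getD_cons_succ]
      refine ⟨?_, ?_⟩
      · have := h.1
        rw [List.countP_cons]
        split_ifs <;> omega
      · have := h.2
        rw [List.countP_cons, if_pos (by simpa using hy)]
        omega

lemma length_output_fiveMedians (l : List ℝ) :
    ((fiveMedians l).output d).length = l.length / 5 := by
  fun_induction fiveMedians (ι := ι) l with
  | case1 x₁ x₂ x₃ x₄ x₅ xs ih => simp [ih]; omega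
  | case2 l h =>
    match l, h with
    | [], _ | [_], _ | [_, _], _ | [_, _, _], _ | [_, _, _, _], _ => simp
    | _ :: _ :: _ :: _ :: _ :: _, h => exact absurd rfl (h _ _ _ _ _ _)

lemma steps_fiveMedians_le (l : List ℝ) : (fiveMedians l).steps d ≤ 13 * l.length := by
  fun_induction fiveMedians (ι := ι) l with
  | case1 x₁ x₂ x₃ x₄ x₅ xs ih =>
    have := steps_insertionSort_le d [x₁, x₂, x₃, x₄, x₅]
    simp at this ⊢
    omega
  | case2 l h => simp

/-- If a property is inherited by smaller (or by larger) numbers, it holds for three entries of each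
group of five whose median has it. -/
lemma three_mul_countP_fiveMedians_le (q : ℝ → Bool)
    (hq : (∀ x y, x ≤ y → q y → q x) ∨ ∀ x y, x ≤ y → q x → q y) (l : List ℝ) :
    3 * ((fiveMedians l).output d).countP q ≤ l.countP q := by
  fun_induction fiveMedians (ι := ι) l with
  | case1 x₁ x₂ x₃ x₄ x₅ xs ih =>
    have hp := perm_output_insertionSort d [x₁, x₂, x₃, x₄, x₅]
    have hs := pairwise_output_insertionSort d [x₁, x₂, x₃, x₄, x₅]
    have hl := hp.length_eq
    have hsplit : (x₁ :: x₂ :: x₃ :: x₄ :: x₅ :: xs).countP q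
        = [x₁, x₂, x₃, x₄, x₅].countP q + xs.countP q := by
      rw [← List.countP_append]; rfl
    rw [hsplit, ← hp.countP_eq]
    simp only [output_bind, output_pure]
    generalize (insertionSort [x₁, x₂, x₃, x₄, x₅]).output d = s at hs hl
    match s, hl with
    | [a, b, c, e, f], _ =>
      have : ([a, b, c, e, f].getD 2 x₁) = c := rfl
      rw [this, List.countP_cons]
      by_cases hc : q c
      · have : 3 ≤ [a, b, c, e, f].countP q := by
          simp only [List.pairwise_cons, List.mem_cons, forall_eq_or_imp] at hs
          rcases hq with hq | hq
          · have ha := hq a c (by tauto) hc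
            have hb := hq b c (by tauto) hc
            simp only [List.countP_cons, ha, hb, hc, if_true]
            omega
          · have ha := hq c e (by tauto) hc
            have hb := hq c f (by tauto) hc
            simp only [List.countP_cons, ha, hb, hc, if_true]
            omega
        simp only [hc, if_true]
        omega
      · simp only [hc]
        simp
        omega
  | case2 l h => simp

lemma output_split3 (p : ℝ) (l : List ℝ) :
    (split3 p l).output d =
      (l.filter (· < p), l.filter (· = p), l.filter (p < ·)) := by
  induction l with
  | nil => simp [split3]
  | cons x xs ih =>
    rcases lt_trichotomy x p with h | h | h
    · simp [split3, ih, h, h.ne, h.not_gt]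
    · simp [split3, ih, h]
    · simp [split3, ih, h, h.ne', h.not_gt]

lemma steps_split3_le (p : ℝ) (l : List ℝ) : (split3 p l).steps d ≤ 3 * l.length := by
  induction l with
  | nil => simp [split3]
  | cons x xs ih =>
    simp only [split3, steps_bind, steps_step, steps_lt, steps_ite, steps_pure, List.length_cons]
    split_ifs <;> omega

/-- The median of the medians of five leaves a guaranteed fraction of the list on either side. -/
lemma length_filter_fiveMedians_le {l : List ℝ} {p : ℝ}
    (hp : HasRank ((fiveMedians l).output d) (l.length / 5 / 2) p) :
    2 * (l.filter (· < p)).length + 3 * (l.length / 5) ≤ 2 * l.length ∧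
      2 * (l.filter (p < ·)).length + 3 * (l.length / 5) ≤ 2 * l.length := by
  have hlen := length_output_fiveMedians d l
  have h₁ := three_mul_countP_fiveMedians_le d (p ≤ ·)
    (Or.inr fun x y hxy hx => by simp at *; linarith) l
  have h₂ := three_mul_countP_fiveMedians_le d (· ≤ p)
    (Or.inl fun x y hxy hx => by simp at *; linarith) l
  have e₁ := l.length_eq_countP_add_countP (p := (· < p))
  have e₂ := l.length_eq_countP_add_countP (p := (· ≤ p))
  have e₃ := ((fiveMedians l).output d).length_eq_countP_add_countP (p := (· < p))
  simp only [decide_eq_true_eq, not_lt, not_le] at e₁ e₂ e₃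
  obtain ⟨ha, hb⟩ := hp
  rw [← List.countP_eq_length_filter, ← List.countP_eq_length_filter]
  omega

lemma HasRank.of_filter_lt {l : List ℝ} {k : ℕ} {p q : ℝ}
    (h : HasRank (l.filter (· < p)) k q) : HasRank l k q := by
  have hq : q < p := by simpa using (List.mem_filter.1 h.mem).2
  have e₁ : (l.filter (· < p)).countP (· < q) = l.countP (· < q) := by
    rw [List.countP_filter]
    refine List.countP_congr fun x _ => ?_
    simp; intro h; linarith
  have e₂ : (l.filter (· < p)).countP (· ≤ q) = l.countP (· ≤ q) := by
    rw [List.countP_filter]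
    refine List.countP_congr fun x _ => ?_
    simp; intro h; linarith
  rwa [HasRank, e₁, e₂] at h

lemma countP_eq_filter_add_filter (l : List ℝ) (p : ℝ) (P : ℝ → Bool) (hP : ∀ x ≤ p, P x) :
    l.countP P =
      (l.filter (· < p)).length + (l.filter (· = p)).length + (l.filter (p < ·)).countP P := by
  induction l with
  | nil => simp
  | cons x xs ih =>
    rcases lt_trichotomy x p with h | h | h
    · simp [h, h.ne, h.not_gt, ih, hP x h.le]; omega
    · simp [h, ih, hP p le_rfl]; omega
    · simp [h, h.ne', h.not_gt, ih, List.countP_cons]; omega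

lemma HasRank.of_filter_gt {l : List ℝ} {k : ℕ} {p q : ℝ}
    (hk : (l.filter (· < p)).length + (l.filter (· = p)).length ≤ k)
    (h : HasRank (l.filter (p < ·))
      (k - (l.filter (· < p)).length - (l.filter (· = p)).length) q) : HasRank l k q := by
  have hq : p < q := by simpa using (List.mem_filter.1 h.mem).2
  have e₁ := countP_eq_filter_add_filter l p (· < q) fun x hx => by simp; linarith
  have e₂ := countP_eq_filter_add_filter l p (· ≤ q) fun x hx => by simp; linarith
  unfold HasRank at *
  omega

lemma length_filter_trichotomy (l : List ℝ) (p : ℝ) :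
    (l.filter (· < p)).length + (l.filter (· = p)).length + (l.filter (p < ·)).length
      = l.length := by
  have := countP_eq_filter_add_filter l p (fun _ => true) fun _ _ => rfl
  simp at this
  omega

lemma hasRank_of_length_filter {l : List ℝ} {k : ℕ} {p : ℝ}
    (h₁ : (l.filter (· < p)).length ≤ k)
    (h₂ : k < (l.filter (· < p)).length + (l.filter (· = p)).length) : HasRank l k p := by
  refine ⟨by rwa [List.countP_eq_length_filter], ?_⟩
  have := countP_eq_filter_add_filter l p (· ≤ p) fun x hx => by simpa using hx
  omega

lemma hasRank_output_select (fuel : ℕ) (x₀ : ℝ) (k : ℕ) (l : List ℝ) (hf : l.length ≤ fuel)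
    (hk : k < l.length) : HasRank l k ((select fuel x₀ k l).output d) := by
  induction fuel generalizing k l with
  | zero => omega
  | succ fuel ih =>
    simp only [select, output_bind, output_listLength, output_ite, output_pure]
    by_cases h : l.length < 5
    · rw [if_pos h]
      have hp := perm_output_insertionSort d l
      exact (hasRank_getD_of_pairwise (pairwise_output_insertionSort d l)
        (hp.length_eq ▸ hk) x₀).perm hp
    · rw [if_neg h]
      have hm := length_output_fiveMedians d l
      have hp := ih (l.length / 5 / 2) ((fiveMedians l).output d) (by omega) (by omega)
      generalize (select fuel x₀ (l.length / 5 / 2) ((fiveMedians l).output d)).output d = p at *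
      have hs := length_filter_fiveMedians_le d hp
      have ht := length_filter_trichotomy l p
      simp only [output_split3]
      split_ifs with h₁ h₂
      · exact (ih k _ (by omega) h₁).of_filter_lt
      · exact hasRank_of_length_filter (not_lt.1 h₁) h₂
      · exact HasRank.of_filter_gt (not_lt.1 h₂) (ih _ _ (by omega) (by omega))

/-- For lists of length `n ≥ 5` the two recursive calls together treat at most `n - n / 18` entries,
and the rest of the work takes at most `20 n` steps; hence any constant from `18 * 20` on
suffices. -/
lemma steps_select_le (fuel : ℕ) (x₀ : ℝ) (k : ℕ) (l : List ℝ) (hf : l.length ≤ fuel) :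
    (select fuel x₀ k l).steps d ≤ 400 * l.length := by
  induction fuel generalizing k l with
  | zero => simp [select]
  | succ fuel ih =>
    simp only [select, steps_bind, steps_listLength, output_listLength, steps_ite, steps_pure]
    by_cases h : l.length < 5
    · rw [if_pos h]
      have := steps_insertionSort_le d l
      nlinarith
    · rw [if_neg h]
      have hm := length_output_fiveMedians d l
      have h5 := steps_fiveMedians_le d l
      have hp := hasRank_output_select d fuel x₀ (l.length / 5 / 2) ((fiveMedians l).output d)
        (by omega) (by omega)
      have hc := ih (l.length / 5 / 2) ((fiveMedians l).output d) (by omega)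
      generalize (select fuel x₀ (l.length / 5 / 2) ((fiveMedians l).output d)).output d = p at *
      have hs := length_filter_fiveMedians_le d hp
      have ht := length_filter_trichotomy l p
      have h3 := steps_split3_le d p l
      simp only [output_split3]
      split_ifs with h₁ h₂
      · have := ih k (l.filter (· < p)) (by omega)
        omega
      · omega
      · have := ih (k - (l.filter (· < p)).length - (l.filter (· = p)).length)
          (l.filter (p < ·)) (by omega)
        omega

end Selection

/-! ### Lines, crossings and envelopes -/

section Lines

variable {ι : Type} (d : ι → ℝ)

open SpeedPlanning.Comp

/-- The ordinate of the line at the abscissa `x`. -/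
def Line.eval (l : Line ℝ) (x : ℝ) : ℝ := l.slope * x + l.icept

lemma Line.eval_eq_add (l : Line ℝ) (x x' : ℝ) : l.eval x' = l.eval x + l.slope * (x' - x) := by
  unfold Line.eval; ring

@[simp] lemma output_line_at (l : Line ℝ) (x : ℝ) : (l.at x : Comp ι ℝ ℝ).output d = l.eval x :=
  rfl

@[simp] lemma steps_line_at (l : Line ℝ) (x : ℝ) : (l.at x : Comp ι ℝ ℝ).steps d = 2 := rfl

/-- The constraint that the line imposes on the point `(x, y)`: it is a lower bound on `y` if
`isMax` is true and an upper bound otherwise. -/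
def Line.Bounds (isMax : Bool) (l : Line ℝ) (x y : ℝ) : Prop :=
  if isMax then l.eval x ≤ y else y ≤ l.eval x

@[simp] lemma Line.bounds_true (l : Line ℝ) (x y : ℝ) : l.Bounds true x y ↔ l.eval x ≤ y := by
  simp [Line.Bounds]

@[simp] lemma Line.bounds_false (l : Line ℝ) (x y : ℝ) : l.Bounds false x y ↔ y ≤ l.eval x := by
  simp [Line.Bounds]

/-- Of two comparable lines, the tighter one decides. -/
lemma Line.bounds_iff_and {isMax : Bool} {l l' : Line ℝ} {x : ℝ}
    (h : if isMax then l'.eval x ≤ l.eval x else l.eval x ≤ l'.eval x) (y : ℝ) :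
    l.Bounds isMax x y ↔ l.Bounds isMax x y ∧ l'.Bounds isMax x y := by
  cases isMax <;> simp at * <;> intro <;> linarith

@[simp] lemma output_beats_true (x y : ℝ) :
    (beats true x y : Comp ι ℝ Bool).output d = decide (y < x) := rfl

@[simp] lemma output_beats_false (x y : ℝ) :
    (beats false x y : Comp ι ℝ Bool).output d = decide (x < y) := rfl

@[simp] lemma steps_beats (isMax : Bool) (x y : ℝ) :
    (beats isMax x y : Comp ι ℝ Bool).steps d = 1 := by
  cases isMax <;> rfl

/-- The two lines of a crossing meet at its abscissa, and the slope of `flat` is the smaller one. -/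
def Crossing.IsProper (c : Crossing ℝ) : Prop :=
  c.flat.slope < c.steep.slope ∧ c.flat.eval c.pos = c.steep.eval c.pos

lemma Crossing.IsProper.steep_sub_flat {c : Crossing ℝ} (hc : c.IsProper) (x : ℝ) :
    c.steep.eval x - c.flat.eval x = (c.steep.slope - c.flat.slope) * (x - c.pos) := by
  rw [c.steep.eval_eq_add c.pos x, c.flat.eval_eq_add c.pos x, hc.2]; ring

lemma Crossing.IsProper.flat_le_steep {c : Crossing ℝ} (hc : c.IsProper) {x : ℝ} (hx : c.pos ≤ x) :
    c.flat.eval x ≤ c.steep.eval x := by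
  have := hc.steep_sub_flat x
  nlinarith [mul_nonneg (sub_nonneg.2 hc.1.le) (sub_nonneg.2 hx)]

lemma Crossing.IsProper.steep_le_flat {c : Crossing ℝ} (hc : c.IsProper) {x : ℝ} (hx : x ≤ c.pos) :
    c.steep.eval x ≤ c.flat.eval x := by
  have := hc.steep_sub_flat x
  nlinarith [mul_nonneg (sub_nonneg.2 hc.1.le) (sub_nonneg.2 hx)]

lemma Crossing.IsProper.flat_le_steep_iff {c : Crossing ℝ} (hc : c.IsProper) {x : ℝ} :
    c.flat.eval x ≤ c.steep.eval x ↔ c.pos ≤ x := by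
  refine ⟨fun h => ?_, hc.flat_le_steep⟩
  by_contra! hx
  have := hc.steep_sub_flat x
  nlinarith [mul_pos (sub_pos.2 hc.1) (sub_pos.2 hx)]

lemma Crossing.IsProper.steep_le_flat_iff {c : Crossing ℝ} (hc : c.IsProper) {x : ℝ} :
    c.steep.eval x ≤ c.flat.eval x ↔ x ≤ c.pos := by
  refine ⟨fun h => ?_, hc.steep_le_flat⟩
  by_contra! hx
  have := hc.steep_sub_flat x
  nlinarith [mul_pos (sub_pos.2 hc.1) (sub_pos.2 hx)]

lemma output_crossing (f s : Line ℝ) : (crossing f s : Comp ι ℝ _).output d =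
    ⟨(f.icept - s.icept) / (s.slope - f.slope), f, s⟩ := rfl

@[simp] lemma steps_crossing (f s : Line ℝ) : (crossing f s : Comp ι ℝ _).steps d = 3 := rfl

@[simp] lemma output_crossing_flat (f s : Line ℝ) :
    ((crossing f s : Comp ι ℝ _).output d).flat = f := rfl

@[simp] lemma output_crossing_steep (f s : Line ℝ) :
    ((crossing f s : Comp ι ℝ _).output d).steep = s := rfl

lemma isProper_output_crossing {f s : Line ℝ} (h : f.slope < s.slope) :
    ((crossing f s : Comp ι ℝ _).output d).IsProper := by
  refine ⟨h, ?_⟩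
  rw [output_crossing]
  simp only [Line.eval]
  have : s.slope - f.slope ≠ 0 := by linarith
  field_simp
  ring

lemma output_resolve (isMax : Bool) (lo hi : ℝ) (c : Crossing ℝ) :
    (resolve isMax lo hi c : Comp ι ℝ _).output d =
      if lo < c.pos then
        if c.pos < hi then none else some (if isMax then c.flat else c.steep)
      else some (if isMax then c.steep else c.flat) := by
  simp [resolve]

lemma steps_resolve_le (isMax : Bool) (lo hi : ℝ) (c : Crossing ℝ) :
    (resolve isMax lo hi c : Comp ι ℝ _).steps d ≤ 2 := by
  simp only [resolve, steps_bind, steps_lt, steps_ite, steps_pure]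
  split_ifs <;> simp

/-- Either the crossing lies in the interior of the interval or the line that is kept makes the
other one redundant. -/
lemma output_resolve_spec (isMax : Bool) (lo hi : ℝ) {c : Crossing ℝ} (hc : c.IsProper) :
    ((resolve isMax lo hi c : Comp ι ℝ _).output d = none ∧ lo < c.pos ∧ c.pos < hi) ∨
    ∃ l, (resolve isMax lo hi c : Comp ι ℝ _).output d = some l ∧ ¬ (lo < c.pos ∧ c.pos < hi) ∧
      ∀ x ∈ Set.Icc lo hi, ∀ y,
        l.Bounds isMax x y ↔ c.flat.Bounds isMax x y ∧ c.steep.Bounds isMax x y := by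
  rw [output_resolve]
  by_cases h₁ : lo < c.pos
  · by_cases h₂ : c.pos < hi
    · exact Or.inl (by simp [h₁, h₂])
    · refine Or.inr ⟨_, by simp only [h₁, h₂, if_true, if_false]; rfl, by simp [h₂],
        fun x hx y => ?_⟩
      have := hc.steep_le_flat (hx.2.trans (not_lt.1 h₂))
      cases isMax <;> simp <;> intros <;> linarith
  · refine Or.inr ⟨_, by simp only [h₁, if_false]; rfl, by simp [h₁], fun x hx y => ?_⟩
    have := hc.flat_le_steep ((not_lt.1 h₁).trans hx.1)
    cases isMax <;> simp <;> intros <;> linarith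

/-- The lines `ls` are represented by the lines `kept` and the crossings `cs`: half as many objects
that impose the same constraints over `[lo, hi]`. -/
structure IsPairing (isMax : Bool) (lo hi : ℝ) (ls kept : List (Line ℝ)) (cs : List (Crossing ℝ)) :
    Prop where
  length_add : kept.length + cs.length = (ls.length + 1) / 2
  length_le : cs.length ≤ ls.length / 2
  proper : ∀ c ∈ cs, c.IsProper
  interior : ∀ c ∈ cs, lo < c.pos ∧ c.pos < hi
  bounds : ∀ x ∈ Set.Icc lo hi, ∀ y, (∀ l ∈ ls, l.Bounds isMax x y) ↔
    (∀ l ∈ kept, l.Bounds isMax x y) ∧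
      ∀ c ∈ cs, c.flat.Bounds isMax x y ∧ c.steep.Bounds isMax x y

namespace IsPairing

variable {isMax : Bool} {lo hi : ℝ} {ls kept : List (Line ℝ)} {cs : List (Crossing ℝ)}

lemma cons_kept (h : IsPairing isMax lo hi ls kept cs) {l l₁ l₂ : Line ℝ}
    (hl : ∀ x ∈ Set.Icc lo hi, ∀ y,
      l.Bounds isMax x y ↔ l₁.Bounds isMax x y ∧ l₂.Bounds isMax x y) :
    IsPairing isMax lo hi (l₁ :: l₂ :: ls) (l :: kept) cs where
  length_add := by have := h.length_add; simp; omega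
  length_le := by have := h.length_le; simp; omega
  proper := h.proper
  interior := h.interior
  bounds x hx y := by
    simp only [List.forall_mem_cons, h.bounds x hx y, hl x hx y]
    tauto

lemma cons_crossing (h : IsPairing isMax lo hi ls kept cs) {c : Crossing ℝ} {l₁ l₂ : Line ℝ}
    (hc : c.IsProper) (hi' : lo < c.pos ∧ c.pos < hi)
    (hl : c.flat = l₁ ∧ c.steep = l₂ ∨ c.flat = l₂ ∧ c.steep = l₁) :
    IsPairing isMax lo hi (l₁ :: l₂ :: ls) kept (c :: cs) where
  length_add := by have := h.length_add; simp; omega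
  length_le := by have := h.length_le; simp; omega
  proper := List.forall_mem_cons.2 ⟨hc, h.proper⟩
  interior := List.forall_mem_cons.2 ⟨hi', h.interior⟩
  bounds x hx y := by
    simp only [List.forall_mem_cons, h.bounds x hx y]
    rcases hl with ⟨e₁, e₂⟩ | ⟨e₁, e₂⟩ <;> rw [e₁, e₂] <;> tauto

end IsPairing

lemma isPairing_output_pairUp (isMax : Bool) (lo hi : ℝ) (ls : List (Line ℝ)) :
    IsPairing isMax lo hi ls ((pairUp isMax lo hi ls : Comp ι ℝ _).output d).1
      ((pairUp isMax lo hi ls : Comp ι ℝ _).output d).2 := by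
  fun_induction pairUp (ι := ι) isMax lo hi ls with
  | case1 l₁ l₂ ls ih =>
    simp only [output_bind, output_lt, decide_eq_true_eq, output_ite]
    split_ifs with h₁ h₂ h₃
    · have hc := isProper_output_crossing d h₁
      rcases output_resolve_spec d isMax lo hi hc with ⟨e, hi⟩ | ⟨l, e, -, hl⟩
      · rw [e]; exact ih.cons_crossing hc hi (Or.inl ⟨rfl, rfl⟩)
      · rw [e]; exact ih.cons_kept hl
    · have hc := isProper_output_crossing d h₂
      rcases output_resolve_spec d isMax lo hi hc with ⟨e, hi⟩ | ⟨l, e, -, hl⟩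
      · rw [e]; exact ih.cons_crossing hc hi (Or.inr ⟨rfl, rfl⟩)
      · rw [e]; exact ih.cons_kept fun x hx y => (hl x hx y).trans and_comm
    · refine ih.cons_kept fun x hx y => Line.bounds_iff_and ?_ y
      have := le_antisymm (not_lt.1 h₁) (not_lt.1 h₂)
      cases isMax <;> simp [Line.eval, this] at h₃ ⊢ <;> exact h₃.le
    · refine ih.cons_kept fun x hx y => (Line.bounds_iff_and ?_ y).trans and_comm
      have := le_antisymm (not_lt.1 h₁) (not_lt.1 h₂)
      cases isMax <;> simp [Line.eval, this] at h₃ ⊢ <;> exact h₃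
  | case2 ls h =>
    match ls, h with
    | [], _ => constructor <;> simp
    | [_], _ => constructor <;> simp
    | _ :: _ :: _, h => exact absurd rfl (h _ _ _)

lemma steps_pairUp_le (isMax : Bool) (lo hi : ℝ) (ls : List (Line ℝ)) :
    (pairUp isMax lo hi ls : Comp ι ℝ _).steps d ≤ 4 * ls.length := by
  fun_induction pairUp (ι := ι) isMax lo hi ls with
  | case1 l₁ l₂ ls ih =>
    have r₁ := steps_resolve_le d isMax lo hi ((crossing l₁ l₂ : Comp ι ℝ _).output d)
    have r₂ := steps_resolve_le d isMax lo hi ((crossing l₂ l₁ : Comp ι ℝ _).output d)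
    simp only [steps_bind, steps_step, steps_lt, steps_ite, steps_crossing, steps_beats,
      steps_pure, List.length_cons]
    split_ifs
    · split <;> simp only [steps_pure] <;> omega
    · split <;> simp only [steps_pure] <;> omega
    · omega
    · omega
  | case2 ls h => simp

lemma length_output_prune (isMax : Bool) (lo hi : ℝ) (kept : List (Line ℝ))
    (cs : List (Crossing ℝ)) :
    ((prune isMax lo hi kept cs : Comp ι ℝ _).output d).length =
      kept.length + cs.length + cs.countP fun c => lo < c.pos ∧ c.pos < hi := by
  induction cs with
  | nil => simp [prune]
  | cons c cs ih =>
    simp only [prune, output_bind, output_resolve, List.countP_cons, List.length_cons]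
    by_cases h₁ : lo < c.pos
    · by_cases h₂ : c.pos < hi
      · simp [h₁, h₂, ih]; omega
      · simp [h₁, h₂, ih]; omega
    · simp [h₁, ih]; omega

lemma forall_mem_output_prune (isMax : Bool) (lo hi : ℝ) (kept : List (Line ℝ))
    (cs : List (Crossing ℝ)) (hcs : ∀ c ∈ cs, c.IsProper) (x : ℝ) (hx : x ∈ Set.Icc lo hi) (y : ℝ) :
    (∀ l ∈ (prune isMax lo hi kept cs : Comp ι ℝ _).output d, l.Bounds isMax x y) ↔
      (∀ l ∈ kept, l.Bounds isMax x y) ∧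
        ∀ c ∈ cs, c.flat.Bounds isMax x y ∧ c.steep.Bounds isMax x y := by
  induction cs with
  | nil => simp [prune]
  | cons c cs ih =>
    rw [List.forall_mem_cons] at hcs
    simp only [prune, output_bind]
    rcases output_resolve_spec d isMax lo hi hcs.1 with ⟨e, -⟩ | ⟨l, e, -, hl⟩
    · simp only [e, output_pure, List.forall_mem_cons, ih hcs.2]
      tauto
    · simp only [e, output_pure, List.forall_mem_cons, ih hcs.2, hl x hx y]
      tauto

lemma steps_prune_le (isMax : Bool) (lo hi : ℝ) (kept : List (Line ℝ)) (cs : List (Crossing ℝ)) :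
    (prune isMax lo hi kept cs : Comp ι ℝ _).steps d ≤ 3 * cs.length := by
  induction cs with
  | nil => simp [prune]
  | cons c cs ih =>
    have := steps_resolve_le d isMax lo hi c
    simp only [prune, steps_bind, steps_step, List.length_cons]
    split <;> simp only [steps_pure] <;> omega

lemma output_positions (cs cs' : List (Crossing ℝ)) :
    (positions cs cs' : Comp ι ℝ _).output d = (cs ++ cs').map Crossing.pos := by
  fun_induction positions (ι := ι) cs cs' <;> simp_all

lemma steps_positions (cs cs' : List (Crossing ℝ)) :
    (positions cs cs' : Comp ι ℝ _).steps d = cs.length + cs'.length := by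
  fun_induction positions (ι := ι) cs cs' <;> simp_all <;> omega

/-- The data of the envelope at `x` that the algorithm uses: its value, and lines through that
value with the slopes `left` and `right`. -/
def IsGerm (isMax : Bool) (x : ℝ) (ls : List (Line ℝ)) : Option (Germ ℝ) → Prop
  | none => ls = []
  | some e => (∀ l ∈ ls, l.Bounds isMax x e.val) ∧
      (∃ l ∈ ls, l.eval x = e.val ∧ l.slope = e.left) ∧
      ∃ l ∈ ls, l.eval x = e.val ∧ l.slope = e.right

lemma isGerm_output_envelope (isMax : Bool) (x : ℝ) (ls : List (Line ℝ)) :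
    IsGerm isMax x ls ((envelope isMax x ls : Comp ι ℝ _).output d) := by
  induction ls with
  | nil => simp [envelope, IsGerm]
  | cons l ls ih =>
    simp only [envelope, output_bind, output_line_at]
    generalize (envelope isMax x ls : Comp ι ℝ _).output d = o at ih
    match o, ih with
    | none, ih =>
      obtain rfl : ls = [] := ih
      cases isMax <;> simp [IsGerm]
    | some e, ⟨hb, ⟨l₁, hl₁, v₁, s₁⟩, ⟨l₂, hl₂, v₂, s₂⟩⟩ =>
      cases isMax
      all_goals
        simp only [output_bind, output_beats_true, output_beats_false, output_ite, output_pure,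
          decide_eq_true_eq]
        split_ifs
      -- either `l` is a new extreme line, or the value is that of the lines before
      all_goals first
      | refine ⟨List.forall_mem_cons.2 ⟨by simp; linarith, hb⟩, ?_, ?_⟩
        · first
          | exact ⟨l₁, by simp [hl₁], v₁, s₁⟩
          | exact ⟨l, by simp, by linarith, rfl⟩
        · first
          | exact ⟨l₂, by simp [hl₂], v₂, s₂⟩
          | exact ⟨l, by simp, by linarith, rfl⟩
      | refine ⟨List.forall_mem_cons.2 ⟨by simp, fun l' hl' => ?_⟩,
          ⟨l, by simp, rfl, rfl⟩, ⟨l, by simp, rfl, rfl⟩⟩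
        have := hb l' hl'
        simp at this ⊢
        linarith

lemma steps_envelope_le (isMax : Bool) (x : ℝ) (ls : List (Line ℝ)) :
    (envelope isMax x ls : Comp ι ℝ _).steps d ≤ 7 * ls.length := by
  induction ls with
  | nil => simp [envelope]
  | cons l ls ih =>
    simp only [envelope, steps_bind, steps_step, steps_line_at, List.length_cons]
    split
    · simp only [steps_pure]; omega
    · simp only [steps_bind, steps_beats, steps_ite, steps_pure]
      split_ifs <;> omega

end Lines

/-! ### Linear programs in two variables -/

section LinearProgram

variable {ι : Type} (d : ι → ℝ)

open SpeedPlanning.Comp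

/-- `(x, y)` satisfies the constraints of the linear program in normal form. -/
def IsFeasible (lower upper : List (Line ℝ)) (lo hi x y : ℝ) : Prop :=
  x ∈ Set.Icc lo hi ∧ (∀ l ∈ lower, l.Bounds true x y) ∧ ∀ l ∈ upper, l.Bounds false x y

/-- A result of the linear program: `none` if it is infeasible, and otherwise a feasible point of
least ordinate. -/
def IsSolution (lower upper : List (Line ℝ)) (lo hi : ℝ) : Option (ℝ × ℝ) → Prop
  | none => ∀ x y, ¬ IsFeasible lower upper lo hi x y
  | some (x, y) => IsFeasible lower upper lo hi x y ∧
      ∀ x' y', IsFeasible lower upper lo hi x' y' → y ≤ y'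

lemma IsSolution.congr {lower upper lower' upper' : List (Line ℝ)} {lo hi lo' hi' : ℝ}
    {o : Option (ℝ × ℝ)} (h : IsSolution lower upper lo hi o)
    (hiff : ∀ x y, IsFeasible lower upper lo hi x y ↔ IsFeasible lower' upper' lo' hi' x y) :
    IsSolution lower' upper' lo' hi' o := by
  match o with
  | none => exact fun x y => (hiff x y).not.1 (h x y)
  | some (x, y) => exact ⟨(hiff x y).1 h.1, fun x' y' hf => h.2 x' y' ((hiff x' y').2 hf)⟩

/-- The interval may be cut if no point that is cut off is better than all the remaining ones. -/
lemma IsSolution.of_subinterval {lower upper : List (Line ℝ)} {lo hi lo' hi' : ℝ}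
    {o : Option (ℝ × ℝ)} (h : IsSolution lower upper lo' hi' o) (hlo : lo ≤ lo') (hhi : hi' ≤ hi)
    (hcut : ∀ x y, IsFeasible lower upper lo hi x y → x ∉ Set.Icc lo' hi' →
      ∃ x' y', IsFeasible lower upper lo' hi' x' y' ∧ y' ≤ y) :
    IsSolution lower upper lo hi o := by
  have key : ∀ x y, IsFeasible lower upper lo hi x y →
      ∃ x' y', IsFeasible lower upper lo' hi' x' y' ∧ y' ≤ y := fun x y hf => by
    by_cases hx : x ∈ Set.Icc lo' hi'
    · exact ⟨x, y, ⟨hx, hf.2⟩, le_rfl⟩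
    · exact hcut x y hf hx
  match o with
  | none =>
    intro x y hf
    obtain ⟨x', y', hf', -⟩ := key x y hf
    exact h x' y' hf'
  | some (x, y) =>
    refine ⟨⟨⟨hlo.trans h.1.1.1, h.1.1.2.trans hhi⟩, h.1.2⟩, fun x' y' hf => ?_⟩
    obtain ⟨x'', y'', hf', hy⟩ := key x' y' hf
    exact (h.2 x'' y'' hf').trans hy

lemma steps_minimizeLine_le (l : Line ℝ) (lo hi : ℝ) :
    (minimizeLine l lo hi : Comp ι ℝ _).steps d ≤ 5 := by
  simp only [minimizeLine, steps_bind, steps_lt, steps_ite, steps_pure, steps_number,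
    steps_line_at]
  split_ifs <;> simp

lemma isSolution_output_minimizeLine (l : Line ℝ) (lo hi : ℝ) :
    IsSolution [l] [] lo hi ((minimizeLine l lo hi : Comp ι ℝ _).output d) := by
  by_cases h : hi < lo
  · have : (minimizeLine l lo hi : Comp ι ℝ _).output d = none := by simp [minimizeLine, h]
    rw [this]
    exact fun x y hf => (hf.1.1.trans hf.1.2).not_gt h
  · have : (minimizeLine l lo hi : Comp ι ℝ _).output d =
        some (if l.slope < 0 then hi else lo, l.eval (if l.slope < 0 then hi else lo)) := by
      simp [minimizeLine, h]
    rw [this]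
    rw [not_lt] at h
    split_ifs with hs
    · refine ⟨by simp [IsFeasible, h], fun x y hf => ?_⟩
      have := hf.2.1 l (by simp)
      rw [Line.bounds_true, l.eval_eq_add hi] at this
      nlinarith [hf.1.2]
    · refine ⟨by simp [IsFeasible, h], fun x y hf => ?_⟩
      have := hf.2.1 l (by simp)
      rw [Line.bounds_true, l.eval_eq_add lo] at this
      nlinarith [mul_nonneg (not_lt.1 hs) (sub_nonneg.2 hf.1.1)]

lemma steps_solveTwo_le (l h : Line ℝ) (lo hi : ℝ) :
    (solveTwo l h lo hi : Comp ι ℝ _).steps d ≤ 11 := by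
  have hm := fun lo hi => steps_minimizeLine_le d l lo hi
  simp only [solveTwo, steps_bind, steps_lt, steps_ite, steps_pure, steps_crossing]
  have h₁ := hm lo hi
  split_ifs <;> grind

lemma isSolution_output_solveTwo (l h : Line ℝ) (lo hi : ℝ) :
    IsSolution [l] [h] lo hi ((solveTwo l h lo hi : Comp ι ℝ _).output d) := by
  -- restrict the abscissae to the interval where `l` is below `h`
  have key : ∀ lo' hi', (∀ x, x ∈ Set.Icc lo' hi' ↔ x ∈ Set.Icc lo hi ∧ l.eval x ≤ h.eval x) →
      IsSolution [l] [h] lo hi ((minimizeLine l lo' hi' : Comp ι ℝ _).output d) := by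
    intro lo' hi' H
    have hm := isSolution_output_minimizeLine d l lo' hi'
    by_cases hlt : hi' < lo'
    · have : (minimizeLine l lo' hi' : Comp ι ℝ _).output d = none := by simp [minimizeLine, hlt]
      rw [this]
      intro x y hf
      have h₁ : l.eval x ≤ y := by simpa using hf.2.1
      have h₂ : y ≤ h.eval x := by simpa using hf.2.2
      have := (H x).2 ⟨hf.1, h₁.trans h₂⟩
      exact (this.1.trans this.2).not_gt hlt
    · have : (minimizeLine l lo' hi' : Comp ι ℝ _).output d =
          some (if l.slope < 0 then hi' else lo', l.eval (if l.slope < 0 then hi' else lo')) := by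
        simp [minimizeLine, hlt]
      rw [this] at hm ⊢
      have hx := (H _).1 hm.1.1
      refine ⟨⟨hx.1, hm.1.2.1, by simpa using hx.2⟩, fun x y hf => hm.2 x y ⟨?_, hf.2.1, by simp⟩⟩
      have h₁ : l.eval x ≤ y := by simpa using hf.2.1
      have h₂ : y ≤ h.eval x := by simpa using hf.2.2
      exact (H x).2 ⟨hf.1, h₁.trans h₂⟩
  simp only [solveTwo, output_bind, output_lt, decide_eq_true_eq, output_ite, output_pure]
  split_ifs with h₁ h₂ h₃ h₄ h₅
  -- `l` is flatter than `h`: the abscissae are those from the crossing on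
  iterate 2
    refine key _ _ fun x => ?_
    have hc := (isProper_output_crossing d h₁).flat_le_steep_iff (x := x)
    rw [output_crossing_flat, output_crossing_steep] at hc
    simp only [Set.mem_Icc, hc]
    constructor <;> rintro ⟨_, _⟩ <;> refine ⟨?_, ?_⟩ <;> grind
  -- `l` is steeper than `h`: the abscissae are those up to the crossing
  iterate 2
    refine key _ _ fun x => ?_
    have hc := (isProper_output_crossing d h₃).steep_le_flat_iff (x := x)
    rw [output_crossing_flat, output_crossing_steep] at hc
    simp only [Set.mem_Icc, hc]
    constructor <;> rintro ⟨_, _⟩ <;> refine ⟨?_, ?_⟩ <;> grind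
  · intro x y hf
    have h₁ : l.eval x ≤ y := by simpa using hf.2.1
    have h₂ : y ≤ h.eval x := by simpa using hf.2.2
    grind [Line.eval]
  · refine key _ _ fun x => ?_
    have : l.eval x ≤ h.eval x := by grind [Line.eval]
    simp [this]

/-- Every verdict is justified. -/
def Verdict.IsValid (lower upper : List (Line ℝ)) (lo hi x y : ℝ) : Verdict → Prop
  | .goLeft => ∀ o, IsSolution lower upper lo x o → IsSolution lower upper lo hi o
  | .goRight => ∀ o, IsSolution lower upper x hi o → IsSolution lower upper lo hi o
  | .optimal => IsSolution lower upper lo hi (some (x, y))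
  | .infeasible => IsSolution lower upper lo hi none

/-- On either side of the tested abscissa, one line through the germ of each envelope bounds the
feasible ordinates; the comparison of these lines justifies the verdict. -/
lemma isValid_output_judge {lower upper : List (Line ℝ)} {lo hi x : ℝ} (hx : x ∈ Set.Icc lo hi)
    {g : Germ ℝ} {h : Option (Germ ℝ)} (hg : IsGerm true x lower (some g))
    (hh : IsGerm false x upper h) :
    Verdict.IsValid lower upper lo hi x g.val ((judge g h : Comp ι ℝ _).output d) := by
  obtain ⟨gb, ⟨l₁, hl₁, v₁, s₁⟩, ⟨l₂, hl₂, v₂, s₂⟩⟩ := hg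
  have gleft : ∀ x' y', IsFeasible lower upper lo hi x' y' → g.val + g.left * (x' - x) ≤ y' :=
    fun x' y' hf => by
      have := hf.2.1 l₁ hl₁
      rwa [Line.bounds_true, l₁.eval_eq_add x, v₁, s₁] at this
  have gright : ∀ x' y', IsFeasible lower upper lo hi x' y' → g.val + g.right * (x' - x) ≤ y' :=
    fun x' y' hf => by
      have := hf.2.1 l₂ hl₂
      rwa [Line.bounds_true, l₂.eval_eq_add x, v₂, s₂] at this
  -- if `x` is feasible, the part of the interval where `y` cannot improve may be dropped
  have dropLeft (hf₀ : IsFeasible lower upper lo hi x g.val) (hr : g.right < 0) :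
      Verdict.IsValid lower upper lo hi x g.val .goRight := fun o ho =>
    ho.of_subinterval hx.1 le_rfl fun x' y' hf hx' =>
      ⟨x, g.val, ⟨⟨le_rfl, hx.2⟩, hf₀.2⟩, by
        have : x' < x := by
          by_contra! hlt
          exact hx' ⟨hlt, hf.1.2⟩
        nlinarith [gright x' y' hf, mul_pos_of_neg_of_neg hr (sub_neg.2 this)]⟩
  have dropRight (hf₀ : IsFeasible lower upper lo hi x g.val) (hl : 0 < g.left) :
      Verdict.IsValid lower upper lo hi x g.val .goLeft := fun o ho =>
    ho.of_subinterval le_rfl hx.2 fun x' y' hf hx' =>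
      ⟨x, g.val, ⟨⟨hx.1, le_rfl⟩, hf₀.2⟩, by
        have : x < x' := by
          by_contra! hlt
          exact hx' ⟨hf.1.1, hlt⟩
        nlinarith [gleft x' y' hf, mul_pos hl (sub_pos.2 this)]⟩
  match h, hh with
  | none, hh =>
    obtain rfl : upper = [] := hh
    have hf₀ : IsFeasible lower [] lo hi x g.val := ⟨hx, gb, by simp⟩
    simp only [judge, output_bind, output_number, output_lt, decide_eq_true_eq, output_ite,
      output_pure, Int.cast_zero]
    split_ifs with h₁ h₂
    · exact dropLeft hf₀ h₁
    · exact dropRight hf₀ h₂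
    · refine ⟨hf₀, fun x' y' hf => ?_⟩
      have h₃ := gleft x' y' hf
      have h₄ := gright x' y' hf
      rcases le_total x x' with hle | hle <;> nlinarith
  | some h, ⟨hb, ⟨m₁, hm₁, w₁, t₁⟩, ⟨m₂, hm₂, w₂, t₂⟩⟩ =>
    have hleft : ∀ x' y', IsFeasible lower upper lo hi x' y' → y' ≤ h.val + h.left * (x' - x) :=
      fun x' y' hf => by
        have := hf.2.2 m₁ hm₁
        rwa [Line.bounds_false, m₁.eval_eq_add x, w₁, t₁] at this
    have hright : ∀ x' y', IsFeasible lower upper lo hi x' y' → y' ≤ h.val + h.right * (x' - x) :=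
      fun x' y' hf => by
        have := hf.2.2 m₂ hm₂
        rwa [Line.bounds_false, m₂.eval_eq_add x, w₂, t₂] at this
    simp only [judge, output_bind, output_number, output_lt, decide_eq_true_eq, output_ite,
      output_pure, Int.cast_zero, Bool.and_eq_true, Bool.or_eq_true, Bool.not_eq_true',
      decide_eq_false_iff_not, not_lt]
    split_ifs with h₁ h₂ h₃ h₄ h₅
    · refine fun o ho => ho.of_subinterval hx.1 le_rfl fun x' y' hf hx' => ?_
      have : x' < x := by
        by_contra! hlt
        exact hx' ⟨hlt, hf.1.2⟩
      nlinarith [gright x' y' hf, hright x' y' hf]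
    · refine fun o ho => ho.of_subinterval le_rfl hx.2 fun x' y' hf hx' => ?_
      have : x < x' := by
        by_contra! hlt
        exact hx' ⟨hf.1.1, hlt⟩
      nlinarith [gleft x' y' hf, hleft x' y' hf]
    · intro x' y' hf
      have e₁ := gleft x' y' hf
      have e₂ := gright x' y' hf
      have e₃ := hleft x' y' hf
      have e₄ := hright x' y' hf
      rcases le_total x x' with hle | hle <;> nlinarith
    all_goals
      have hf₀ : IsFeasible lower upper lo hi x g.val := ⟨hx, gb, fun l hl => by
        have := hb l hl
        simp at this ⊢
        linarith⟩
    · exact dropLeft hf₀ h₄.1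
    · exact dropRight hf₀ h₅.1
    · refine ⟨hf₀, fun x' y' hf => ?_⟩
      have e₁ := gleft x' y' hf
      have e₂ := gright x' y' hf
      have e₃ := hleft x' y' hf
      have e₄ := hright x' y' hf
      rcases lt_trichotomy x x' with hlt | rfl | hlt
      · by_cases hr : g.right < 0
        · -- no point to the right of `x` is feasible
          have : g.val = h.val ∧ h.right < g.right := by
            by_contra hcon
            refine h₄ ⟨hr, ?_⟩
            by_contra! hcon'
            exact hcon ⟨le_antisymm (not_lt.1 h₁) hcon'.1, hcon'.2⟩
          nlinarith [mul_pos (sub_pos.2 this.2) (sub_pos.2 hlt)]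
        · nlinarith
      · linarith
      · by_cases hl : 0 < g.left
        · -- no point to the left of `x` is feasible
          have : g.val = h.val ∧ g.left < h.left := by
            by_contra hcon
            refine h₅ ⟨hl, ?_⟩
            by_contra! hcon'
            exact hcon ⟨le_antisymm (not_lt.1 h₁) hcon'.1, hcon'.2⟩
          nlinarith [mul_pos (sub_pos.2 this.2) (sub_pos.2 hlt)]
        · nlinarith

lemma steps_judge_le (g : Germ ℝ) (h : Option (Germ ℝ)) :
    (judge g h : Comp ι ℝ _).steps d ≤ 7 := by
  cases h <;> simp only [judge, steps_bind, steps_number, steps_lt, steps_ite, steps_pure] <;>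
    split_ifs <;> simp

/-! ### Megiddo's algorithm -/

/-- After the interval has been cut to `[lo', hi']`, the pruned lists of lines pose the same linear
program over it as the original ones. -/
lemma isSolution_of_prune {lower upper kept₁ kept₂ : List (Line ℝ)} {cs₁ cs₂ : List (Crossing ℝ)}
    {lo hi lo' hi' : ℝ} (h₁ : IsPairing true lo hi lower kept₁ cs₁)
    (h₂ : IsPairing false lo hi upper kept₂ cs₂) (hlo : lo ≤ lo') (hhi : hi' ≤ hi)
    {o : Option (ℝ × ℝ)}
    (h : IsSolution ((prune true lo' hi' kept₁ cs₁ : Comp ι ℝ _).output d)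
      ((prune false lo' hi' kept₂ cs₂ : Comp ι ℝ _).output d) lo' hi' o) :
    IsSolution lower upper lo' hi' o := by
  refine h.congr fun x y => and_congr_right fun hx => ?_
  have hx' : x ∈ Set.Icc lo hi := ⟨hlo.trans hx.1, hx.2.trans hhi⟩
  rw [forall_mem_output_prune d true lo' hi' kept₁ cs₁ h₁.proper x hx y,
    forall_mem_output_prune d false lo' hi' kept₂ cs₂ h₂.proper x hx y,
    h₁.bounds x hx' y, h₂.bounds x hx' y]

/-- The median `x` of the crossings leaves at most half of them in the interior of either part of
the interval, and every other pair has lost a line. -/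
lemma length_prune_add_length_prune_le {lower upper kept₁ kept₂ : List (Line ℝ)}
    {cs₁ cs₂ : List (Crossing ℝ)} {lo hi x : ℝ} (h₁ : IsPairing true lo hi lower kept₁ cs₁)
    (h₂ : IsPairing false lo hi upper kept₂ cs₂)
    (hx : HasRank ((cs₁ ++ cs₂).map Crossing.pos) ((cs₁ ++ cs₂).length / 2) x)
    (h : 2 ≤ lower.length ∨ 2 ≤ upper.length) (lo' hi' : ℝ)
    (hcut : hi' = x ∨ lo' = x) :
    lower.length + upper.length +
      12 * (((prune true lo' hi' kept₁ cs₁ : Comp ι ℝ _).output d).length +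
        ((prune false lo' hi' kept₂ cs₂ : Comp ι ℝ _).output d).length) ≤
      12 * (lower.length + upper.length) := by
  have hn : 1 ≤ (cs₁ ++ cs₂).length := by
    have := List.length_pos_of_mem hx.mem
    rwa [List.length_map] at this
  have hcount : (cs₁.countP fun c => lo' < c.pos ∧ c.pos < hi') +
      (cs₂.countP fun c => lo' < c.pos ∧ c.pos < hi') ≤ (cs₁ ++ cs₂).length / 2 := by
    rw [← List.countP_append]
    generalize cs₁ ++ cs₂ = cs at hx hn
    unfold HasRank at hx
    rw [List.countP_map, List.countP_map] at hx
    rcases hcut with rfl | rfl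
    · refine (List.countP_mono_left fun c _ hc => ?_).trans hx.1
      simp at hc ⊢
      exact hc.2
    · have hle : (cs.countP fun c => lo' < c.pos ∧ c.pos < hi') ≤
          cs.countP fun c => ¬ ((fun y => decide (y ≤ lo')) ∘ Crossing.pos) c :=
        List.countP_mono_left fun c _ hc => by
          simp at hc ⊢
          exact hc.1
      have := cs.length_eq_countP_add_countP (p := (fun y => decide (y ≤ lo')) ∘ Crossing.pos)
      omega
  have := h₁.length_add
  have := h₁.length_le
  have := h₂.length_add
  have := h₂.length_le
  rw [length_output_prune, length_output_prune]
  rw [List.length_append] at hcount hn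
  generalize lower.length = a at *
  generalize upper.length = b at *
  have : (a + 1) / 2 + a / 2 = a := by omega
  have : (b + 1) / 2 + b / 2 = b := by omega
  have : a + b ≤ 6 * (a / 2 + b / 2) := by rcases h with h | h <;> omega
  omega

lemma megiddoLoop_base {lower upper : List (Line ℝ)} (h₀ : lower ≠ [])
    (h : ¬ (2 ≤ lower.length ∨ 2 ≤ upper.length)) :
    (∃ l, lower = [l] ∧ upper = []) ∨ ∃ l h, lower = [l] ∧ upper = [h] := by
  match lower, upper, h₀, h with
  | [l], [], _, _ => exact Or.inl ⟨l, rfl, rfl⟩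
  | [l], [h], _, _ => exact Or.inr ⟨l, h, rfl, rfl⟩
  | _ :: _ :: _, _, _, h => simp at h
  | [_], _ :: _ :: _, _, h => simp at h

/-- Megiddo's algorithm is correct. The tested abscissa is a crossing in the interior of the interval,
and every round drops a line, so that the counter suffices. -/
lemma isSolution_output_megiddoLoop (fuel : ℕ) (lower upper : List (Line ℝ)) (lo hi : ℝ)
    (h₀ : lower ≠ []) (hle : lo ≤ hi) (hf : lower.length + upper.length ≤ fuel) :
    IsSolution lower upper lo hi ((megiddoLoop fuel lower upper lo hi : Comp ι ℝ _).output d) := by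
  induction fuel generalizing lower upper lo hi with
  | zero => simp_all
  | succ fuel ih =>
    have hpos : 1 ≤ lower.length := List.length_pos_iff.2 h₀
    by_cases h : 2 ≤ lower.length ∨ 2 ≤ upper.length
    swap
    · rcases megiddoLoop_base h₀ h with ⟨l, rfl, rfl⟩ | ⟨l, l', rfl, rfl⟩
      · exact isSolution_output_minimizeLine d l lo hi
      · exact isSolution_output_solveTwo d l l' lo hi
    rw [megiddoLoop]
    rotate_left
    · exact h₀
    · rintro l rfl rfl; simp at h
    · rintro l h' rfl rfl; simp at h
    have h₁ := isPairing_output_pairUp d true lo hi lower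
    have h₂ := isPairing_output_pairUp d false lo hi upper
    simp only [output_bind, output_positions]
    generalize (pairUp true lo hi lower : Comp ι ℝ _).output d = o₁ at h₁
    generalize (pairUp false lo hi upper : Comp ι ℝ _).output d = o₂ at h₂
    obtain ⟨kept₁, cs₁⟩ := o₁
    obtain ⟨kept₂, cs₂⟩ := o₂
    simp only at h₁ h₂ ⊢
    have hadd₁ := h₁.length_add
    have hadd₂ := h₂.length_add
    rcases hp : (cs₁ ++ cs₂).map Crossing.pos with _ | ⟨x₀, xs⟩
    · obtain ⟨rfl, rfl⟩ : cs₁ = [] ∧ cs₂ = [] := by simpa using hp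
      simp only [List.length_nil] at hadd₁ hadd₂
      refine isSolution_of_prune d h₁ h₂ le_rfl le_rfl (ih kept₁ kept₂ lo hi ?_ hle (by omega))
      rw [← List.length_pos_iff]
      omega
    · have hn := congrArg List.length hp
      rw [List.length_map] at hn
      have hx := hasRank_output_select d (x₀ :: xs).length x₀ ((x₀ :: xs).length / 2) (x₀ :: xs)
        le_rfl (Nat.div_lt_self (by simp) (by norm_num))
      simp only [output_bind, output_listLength]
      generalize (select (x₀ :: xs).length x₀ ((x₀ :: xs).length / 2) (x₀ :: xs) :
        Comp ι ℝ ℝ).output d = x at hx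
      rw [← hp, List.length_map] at hx
      have hint : lo < x ∧ x < hi := by
        obtain ⟨c, hc, rfl⟩ := List.mem_map.1 hx.mem
        rcases List.mem_append.1 hc with hc | hc
        · exact h₁.interior c hc
        · exact h₂.interior c hc
      have hlen := length_prune_add_length_prune_le d h₁ h₂ hx h
      have hg := isGerm_output_envelope d true x lower
      have hh := isGerm_output_envelope d false x upper
      generalize (envelope true x lower : Comp ι ℝ _).output d = g at hg
      match g, hg with
      | none, hg => exact absurd hg h₀
      | some g, hg =>
        have hj := isValid_output_judge d ⟨hint.1.le, hint.2.le⟩ hg hh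
        simp only [output_bind]
        generalize (judge g ((envelope false x upper : Comp ι ℝ _).output d) :
          Comp ι ℝ _).output d = v at hj
        have hne : ∀ lo' hi', (prune true lo' hi' kept₁ cs₁ : Comp ι ℝ _).output d ≠ [] := by
          intro lo' hi'
          rw [← List.length_pos_iff, length_output_prune]
          omega
        match v, hj with
        | .infeasible, hj => exact hj
        | .optimal, hj => exact hj
        | .goLeft, hj =>
          have := hlen lo x (Or.inl rfl)
          simp only [output_bind]
          refine hj _ (isSolution_of_prune d h₁ h₂ le_rfl hint.2.le
            (ih _ _ lo x (hne lo x) hint.1.le (Nat.lt_succ_iff.1 ?_)))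
          omega
        | .goRight, hj =>
          have := hlen x hi (Or.inr rfl)
          simp only [output_bind]
          refine hj _ (isSolution_of_prune d h₁ h₂ hint.1.le le_rfl
            (ih _ _ x hi (hne x hi) hint.2.le (Nat.lt_succ_iff.1 ?_)))
          omega

/-- A round on `n` lines takes fewer than `500 n` steps, most of them for the selection of the median
of at most `n / 2` crossings, and leaves at most `11 n / 12` lines. -/
lemma steps_megiddoLoop_le (fuel : ℕ) (lower upper : List (Line ℝ)) (lo hi : ℝ) :
    (megiddoLoop fuel lower upper lo hi : Comp ι ℝ _).steps d ≤
      6000 * (lower.length + upper.length) := by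
  induction fuel generalizing lower upper lo hi with
  | zero => simp [megiddoLoop]
  | succ fuel ih =>
    by_cases h₀ : lower = []
    · subst h₀; simp [megiddoLoop]
    have hpos : 1 ≤ lower.length := List.length_pos_iff.2 h₀
    by_cases h : 2 ≤ lower.length ∨ 2 ≤ upper.length
    swap
    · rcases megiddoLoop_base h₀ h with ⟨l, rfl, rfl⟩ | ⟨l, l', rfl, rfl⟩
      · exact (steps_minimizeLine_le d l lo hi).trans (by simp)
      · exact (steps_solveTwo_le d l l' lo hi).trans (by norm_num)
    rw [megiddoLoop]
    rotate_left
    · exact h₀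
    · rintro l rfl rfl; simp at h
    · rintro l h' rfl rfl; simp at h
    have h₁ := isPairing_output_pairUp d true lo hi lower
    have h₂ := isPairing_output_pairUp d false lo hi upper
    have s₁ := steps_pairUp_le d true lo hi lower
    have s₂ := steps_pairUp_le d false lo hi upper
    simp only [steps_bind, output_positions, steps_positions]
    generalize (pairUp true lo hi lower : Comp ι ℝ _).output d = o₁ at h₁
    generalize (pairUp false lo hi upper : Comp ι ℝ _).output d = o₂ at h₂
    obtain ⟨kept₁, cs₁⟩ := o₁
    obtain ⟨kept₂, cs₂⟩ := o₂
    simp only at h₁ h₂ ⊢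
    have hadd₁ := h₁.length_add
    have hadd₂ := h₂.length_add
    have hle₁ := h₁.length_le
    have hle₂ := h₂.length_le
    rcases hp : (cs₁ ++ cs₂).map Crossing.pos with _ | ⟨x₀, xs⟩
    · obtain ⟨rfl, rfl⟩ : cs₁ = [] ∧ cs₂ = [] := by simpa using hp
      simp only [List.length_nil] at hadd₁ hadd₂ ⊢
      have := ih kept₁ kept₂ lo hi
      omega
    · have hn := congrArg List.length hp
      rw [List.length_map, List.length_append] at hn
      have hx := hasRank_output_select d (x₀ :: xs).length x₀ ((x₀ :: xs).length / 2) (x₀ :: xs)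
        le_rfl (Nat.div_lt_self (by simp) (by norm_num))
      have s₃ := steps_select_le d (x₀ :: xs).length x₀ ((x₀ :: xs).length / 2) (x₀ :: xs) le_rfl
      simp only [steps_bind, output_listLength, steps_listLength]
      generalize (select (x₀ :: xs).length x₀ ((x₀ :: xs).length / 2) (x₀ :: xs) :
        Comp ι ℝ ℝ).output d = x at hx
      rw [← hp, List.length_map] at hx
      have hlen := length_prune_add_length_prune_le d h₁ h₂ hx h
      have s₄ := steps_envelope_le d true x lower
      have s₅ := steps_envelope_le d false x upper
      generalize (envelope true x lower : Comp ι ℝ _).output d = g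
      match g with
      | none => simp only [steps_pure]; omega
      | some g =>
        have s₆ := steps_judge_le d g ((envelope false x upper : Comp ι ℝ _).output d)
        simp only [steps_bind]
        generalize (judge g ((envelope false x upper : Comp ι ℝ _).output d) :
          Comp ι ℝ _).output d = v
        match v with
        | .infeasible => simp only [steps_pure]; omega
        | .optimal => simp only [steps_pure]; omega
        | .goLeft =>
          have := hlen lo x (Or.inl rfl)
          have := steps_prune_le d true lo x kept₁ cs₁
          have := steps_prune_le d false lo x kept₂ cs₂
          have := ih ((prune true lo x kept₁ cs₁ : Comp ι ℝ _).output d)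
            ((prune false lo x kept₂ cs₂ : Comp ι ℝ _).output d) lo x
          simp only [steps_bind]
          omega
        | .goRight =>
          have := hlen x hi (Or.inr rfl)
          have := steps_prune_le d true x hi kept₁ cs₁
          have := steps_prune_le d false x hi kept₂ cs₂
          have := ih ((prune true x hi kept₁ cs₁ : Comp ι ℝ _).output d)
            ((prune false x hi kept₂ cs₂ : Comp ι ℝ _).output d) x hi
          simp only [steps_bind]
          omega

end LinearProgram

/-! ### The forward-backward algorithm -/

section ForwardBackward

open SpeedPlanning.Comp

variable {S : Shape}

namespace Problem

/-- The constraints of the subproblem that belongs to the pair `(v_i, v_{i+1})`, with the upper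
bounds `U` and `W`. -/
def PairFeasible (p : Problem S) (i : Fin S.m) (U W v w : ℝ) : Prop :=
  (∀ j, v ≤ p.f i j w) ∧ (∀ k, w ≤ p.b i k v) ∧ v ∈ Set.Icc 0 U ∧ w ∈ Set.Icc 0 W

lemma Admissible.pairFeasible_zero {p : Problem S} (hp : p.Admissible) (i : Fin S.m) {U W : ℝ}
    (hU : 0 ≤ U) (hW : 0 ≤ W) : p.PairFeasible i U W 0 0 :=
  ⟨fun j => (hp.f_pos i j).le, fun k => (hp.b_pos i k).le, ⟨le_rfl, hU⟩, ⟨le_rfl, hW⟩⟩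

/-- The feasible pairs are closed under componentwise maxima, because the constraint functions are
increasing. -/
lemma Admissible.pairFeasible_sup {p : Problem S} (hp : p.Admissible) {i : Fin S.m}
    {U W v w v' w' : ℝ} (h : p.PairFeasible i U W v w) (h' : p.PairFeasible i U W v' w') :
    p.PairFeasible i U W (max v v') (max w w') := by
  obtain ⟨h₁, h₂, h₃, h₄⟩ := h
  obtain ⟨h₁', h₂', h₃', h₄'⟩ := h'
  have hv : 0 ≤ max v v' := h₃.1.trans (le_max_left _ _)
  have hw : 0 ≤ max w w' := h₄.1.trans (le_max_left _ _)
  refine ⟨fun j => ?_, fun k => ?_, ⟨hv, max_le h₃.2 h₃'.2⟩, ⟨hw, max_le h₄.2 h₄'.2⟩⟩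
  · exact max_le ((h₁ j).trans ((hp.f_increasing i j).monotoneOn h₄.1 hw (le_max_left _ _)))
      ((h₁' j).trans ((hp.f_increasing i j).monotoneOn h₄'.1 hw (le_max_right _ _)))
  · exact max_le ((h₂ k).trans ((hp.b_increasing i k).monotoneOn h₃.1 hv (le_max_left _ _)))
      ((h₂' k).trans ((hp.b_increasing i k).monotoneOn h₃'.1 hv (le_max_right _ _)))

/-- Hence a feasible pair with the largest sum dominates all feasible pairs. -/
lemma Admissible.le_of_add_le {p : Problem S} (hp : p.Admissible) {i : Fin S.m} {U W v w : ℝ}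
    (h : p.PairFeasible i U W v w)
    (hmax : ∀ v' w', p.PairFeasible i U W v' w' → v' + w' ≤ v + w) {v' w' : ℝ}
    (h' : p.PairFeasible i U W v' w') : v' ≤ v ∧ w' ≤ w := by
  have := hmax _ _ (hp.pairFeasible_sup h h')
  have := le_max_left v v'
  have := le_max_right v v'
  have := le_max_left w w'
  have := le_max_right w w'
  constructor <;> linarith

end Problem

variable (d : Addr S → ℝ)

lemma fSlope_pos {d : Addr S → ℝ} (hd : (linearProblem d).Admissible) (i : Fin S.m)
    (j : Fin (S.r i)) : 0 < d (.fSlope i j) := by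
  have := hd.f_increasing i j (a := 0) (b := 1) (by simp) (by simp) one_pos
  simpa [linearProblem] using this

lemma foldl_cons_eq {β γ : Type} (f : β → γ) (l : List β) (s : List γ) :
    l.foldl (fun s x => f x :: s) s = (l.map f).reverse ++ s := by
  induction l generalizing s <;> simp_all

/-- The lower lines of the subproblem for the pair `i`. -/
noncomputable def lowerLines (i : Fin S.m) (W : ℝ) : List (Line ℝ) :=
  ((List.finRange (S.t i)).map fun k =>
    (⟨-1 - d (.bSlope i k), 0 - d (.bConst i k)⟩ : Line ℝ)).reverse ++ [⟨-1, 0 - W⟩]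

/-- The upper lines of the subproblem for the pair `i`. -/
noncomputable def upperLines (i : Fin S.m) : List (Line ℝ) :=
  ((List.finRange (S.r i)).map fun j =>
    (⟨0 - (1 + d (.fSlope i j)) / d (.fSlope i j), d (.fConst i j) / d (.fSlope i j)⟩ :
      Line ℝ)).reverse ++ [⟨-1, 0⟩]

lemma output_solveSubproblem (i : Fin S.m) (U W : ℝ) :
    (solveSubproblem S i U W).output d =
      ((megiddo (lowerLines d i W) (upperLines d i) 0 U : Comp (Addr S) ℝ _).output d).map
        fun z => (z.1, 0 - z.2 - z.1) := by
  simp only [solveSubproblem, output_bind, output_number, output_sub, output_forEach, output_input,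
    output_pure, foldl_cons_eq, output_div, output_add, Int.cast_zero, Int.cast_one, Int.cast_neg]
  rw [← lowerLines, ← upperLines]
  split <;> simp_all

/-- The linear program in normal form is the subproblem in the variables `v` and `-(v + w)`. -/
lemma isFeasible_iff_pairFeasible {d : Addr S → ℝ} (hd : (linearProblem d).Admissible)
    (i : Fin S.m) (U W v w : ℝ) :
    IsFeasible (lowerLines d i W) (upperLines d i) 0 U v (0 - w - v) ↔
      (linearProblem d).PairFeasible i U W v w := by
  have hf : ∀ j, 0 - w - v ≤ (0 - (1 + d (.fSlope i j)) / d (.fSlope i j)) * v +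
      d (.fConst i j) / d (.fSlope i j) ↔ v ≤ d (.fSlope i j) * w + d (.fConst i j) := by
    intro j
    have hα := fSlope_pos hd i j
    have : (0 - (1 + d (.fSlope i j)) / d (.fSlope i j)) * v + d (.fConst i j) / d (.fSlope i j) =
        (d (.fConst i j) - (1 + d (.fSlope i j)) * v) / d (.fSlope i j) := by
      field_simp; ring
    rw [this, le_div_iff₀ hα]
    constructor <;> intro <;> nlinarith
  have hb : ∀ k, (-1 - d (.bSlope i k)) * v + (0 - d (.bConst i k)) ≤ 0 - w - v ↔
      w ≤ d (.bSlope i k) * v + d (.bConst i k) := by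
    intro k
    constructor <;> intro <;> linarith
  simp only [IsFeasible, lowerLines, upperLines, List.forall_mem_append, List.mem_reverse,
    List.forall_mem_map, List.mem_finRange, forall_const, List.forall_mem_singleton,
    Line.bounds_true, Line.bounds_false, Line.eval, hf, hb, Problem.PairFeasible, linearProblem,
    Set.mem_Icc]
  constructor
  · rintro ⟨h₁, ⟨h₂, h₃⟩, h₄, h₅⟩
    exact ⟨h₄, h₂, h₁, by linarith, by linarith⟩
  · rintro ⟨h₁, h₂, h₃, h₄, h₅⟩
    exact ⟨h₃, ⟨h₂, by linarith⟩, h₁, by linarith⟩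

lemma output_solveSubproblem_spec {d : Addr S → ℝ} (hd : (linearProblem d).Admissible)
    (i : Fin S.m) {U W : ℝ} (hU : 0 ≤ U) (hW : 0 ≤ W) :
    ∃ v w, (solveSubproblem S i U W).output d = some (v, w) ∧
      (linearProblem d).PairFeasible i U W v w ∧
      ∀ v' w', (linearProblem d).PairFeasible i U W v' w' → v' ≤ v ∧ w' ≤ w := by
  have h := isSolution_output_megiddoLoop d ((lowerLines d i W).length + (upperLines d i).length)
    (lowerLines d i W) (upperLines d i) 0 U (by simp [lowerLines]) hU le_rfl
  rw [output_solveSubproblem, megiddo]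
  match (megiddoLoop _ (lowerLines d i W) (upperLines d i) 0 U : Comp (Addr S) ℝ _).output d, h with
  | none, h =>
    exact absurd ((isFeasible_iff_pairFeasible hd i U W 0 0).2 (hd.pairFeasible_zero i hU hW))
      (h _ _)
  | some (x, y), h =>
    have hxy : 0 - (0 - y - x) - x = y := by ring
    have hfeas : (linearProblem d).PairFeasible i U W x (0 - y - x) := by
      rw [← isFeasible_iff_pairFeasible hd, hxy]
      exact h.1
    refine ⟨x, 0 - y - x, rfl, hfeas,
      fun v' w' h' => hd.le_of_add_le hfeas (fun v'' w'' h'' => ?_) h'⟩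
    have := h.2 _ _ ((isFeasible_iff_pairFeasible hd i U W v'' w'').2 h'')
    linarith

/-- `a` bounds all feasible vectors from above, and is itself within the box. -/
structure IsBound (p : Problem S) (a : Fin (S.m + 1) → ℝ) : Prop where
  nonneg : ∀ i, 0 ≤ a i
  le_u : ∀ i, a i ≤ p.u i
  le_of_feasible : ∀ w ∈ p.feasible, ∀ i, w i ≤ a i

/-- The property of the pair `i` that the forward phase establishes and the backward phase needs:
the constraints of the second kind hold for `a`, and they persist when `a_{i+1}` is decreased to a
number `x` and `a_i` is decreased to a value `f_j^i (x)`. -/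
def Persists (p : Problem S) (a : Fin (S.m + 1) → ℝ) (i : Fin S.m) : Prop :=
  ∀ k, a i.succ ≤ p.b i k (a i.castSucc) ∧
    ∀ x ∈ Set.Icc 0 (a i.succ), ∀ j, x ≤ p.b i k (p.f i j x)

lemma Persists.mono {p : Problem S} {a a' : Fin (S.m + 1) → ℝ} {i : Fin S.m} (h : Persists p a i)
    (h₁ : a' i.castSucc = a i.castSucc) (h₂ : a' i.succ ≤ a i.succ) : Persists p a' i := fun k =>
  ⟨by rw [h₁]; exact h₂.trans (h k).1, fun x hx => (h k).2 x ⟨hx.1, hx.2.trans h₂⟩⟩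

/-- The composition `b ∘ f` is concave and lies above the identity at `0` and at `w`, hence on
`[0, w]`. -/
lemma Problem.Admissible.le_comp {p : Problem S} (hp : p.Admissible) {i : Fin S.m} {U W v w : ℝ}
    (h : p.PairFeasible i U W v w) {x : ℝ} (hx : x ∈ Set.Icc 0 w) (j : Fin (S.r i))
    (k : Fin (S.t i)) : x ≤ p.b i k (p.f i j x) := by
  have hfnonneg : ∀ y ∈ Set.Ici (0 : ℝ), p.f i j y ∈ Set.Ici (0 : ℝ) := fun y hy =>
    (hp.f_pos i j).le.trans ((hp.f_increasing i j).monotoneOn (by simp) hy hy)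
  have hbmono := (hp.b_increasing i k).monotoneOn
  have hw : w ≤ p.b i k (p.f i j w) :=
    (h.2.1 k).trans (hbmono h.2.2.1.1 (hfnonneg w h.2.2.2.1) (h.1 j))
  have h0 : 0 ≤ p.b i k (p.f i j 0) :=
    (hp.b_pos i k).le.trans (hbmono (by simp) (hfnonneg 0 (by simp)) (hfnonneg 0 (by simp)))
  rcases hx.1.eq_or_lt with rfl | hx0
  · exact h0
  have hwpos : 0 < w := hx0.trans_le hx.2
  have hs : 0 ≤ 1 - x / w := sub_nonneg.2 ((div_le_one hwpos).2 hx.2)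
  have ht : 0 ≤ x / w := by positivity
  have hxw : x / w * w = x := by field_simp
  have hf : (1 - x / w) * p.f i j 0 + x / w * p.f i j w ≤ p.f i j x := by
    have := (hp.f_concave i j).2 (x := 0) (y := w) (by simp) hwpos.le hs ht (by ring)
    simpa [hxw] using this
  have hb := (hp.b_concave i k).2 (hfnonneg 0 (by simp)) (hfnonneg w hwpos.le) hs ht (by ring)
  simp only [smul_eq_mul] at hb
  have hnn : 0 ≤ (1 - x / w) * p.f i j 0 + x / w * p.f i j w :=
    add_nonneg (mul_nonneg hs (hfnonneg 0 (by simp))) (mul_nonneg ht (hfnonneg w hwpos.le))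
  have := hbmono hnn (hfnonneg x hx.1) hf
  nlinarith [mul_nonneg hs h0, mul_le_mul_of_nonneg_left hw ht]

/-- Induction along a loop over all indices: `P k` holds before the iteration with index `k`. -/
lemma foldl_finRange_induction {σ : Type} {m : ℕ} (P : ℕ → σ → Prop) (f : σ → Fin m → σ) (s : σ)
    (h₀ : P 0 s) (hs : ∀ (i : Fin m) s, P i s → P (i + 1) (f s i)) :
    P m ((List.finRange m).foldl f s) := by
  induction m with
  | zero => simpa
  | succ m ih =>
    rw [List.finRange_succ_last, List.foldl_append, List.foldl_map]
    exact hs (Fin.last m) _ (ih (fun s i => f s i.castSucc) fun i => hs i.castSucc)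

/-- Induction along a loop over all indices in decreasing order: `P k` holds after the iteration with
index `k`. -/
lemma foldl_reverse_finRange_induction {σ : Type} {m : ℕ} (P : ℕ → σ → Prop) (f : σ → Fin m → σ)
    (s : σ) (h₀ : P m s) (hs : ∀ (i : Fin m) s, P (i + 1) s → P i (f s i)) :
    P 0 ((List.finRange m).reverse.foldl f s) := by
  induction m generalizing P with
  | zero => simpa
  | succ m ih =>
    rw [List.finRange_succ, List.reverse_cons, List.foldl_append, ← List.map_reverse,
      List.foldl_map]
    exact hs 0 _ (ih (fun k => P (k + 1)) (fun s i => f s i.succ) h₀ fun i => hs i.succ)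

/-- A forward step on the pair `i` keeps all feasible vectors below the bound and makes `i`
persistent; the pairs before `i` stay so, as of their entries only `a_i` is touched, and decreased. -/
lemma output_forwardStep {d : Addr S → ℝ} (hd : (linearProblem d).Admissible) (i : Fin S.m)
    {a : Fin (S.m + 1) → ℝ} (ha : IsBound (linearProblem d) a)
    (hper : ∀ i' < i, Persists (linearProblem d) a i') :
    IsBound (linearProblem d) ((forwardStep S a i).output d) ∧
      ∀ i' ≤ i, Persists (linearProblem d) ((forwardStep S a i).output d) i' := by
  obtain ⟨v, w, hout, hfeas, hmax⟩ :=
    output_solveSubproblem_spec hd i (ha.nonneg i.castSucc) (ha.nonneg i.succ)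
  have hne : i.castSucc ≠ i.succ := i.castSucc_lt_succ.ne
  simp only [forwardStep, output_bind, hout, output_store]
  set a' := Function.update (Function.update a i.castSucc v) i.succ w with ha'
  have e₁ : a' i.castSucc = v := by simp [ha', hne]
  have e₂ : a' i.succ = w := by simp [ha']
  have e₃ : ∀ l, l ≠ i.castSucc → l ≠ i.succ → a' l = a l := fun l h₁ h₂ => by simp [ha', h₁, h₂]
  have hle : ∀ l, a' l ≤ a l := by
    intro l
    by_cases h₁ : l = i.castSucc
    · rw [h₁, e₁]; exact hfeas.2.2.1.2
    by_cases h₂ : l = i.succ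
    · rw [h₂, e₂]; exact hfeas.2.2.2.2
    exact (e₃ l h₁ h₂).le
  refine ⟨⟨fun l => ?_, fun l => (hle l).trans (ha.le_u l), fun z hz l => ?_⟩, fun i' hi' => ?_⟩
  · by_cases h₁ : l = i.castSucc
    · rw [h₁, e₁]; exact hfeas.2.2.1.1
    by_cases h₂ : l = i.succ
    · rw [h₂, e₂]; exact hfeas.2.2.2.1
    rw [e₃ l h₁ h₂]; exact ha.nonneg l
  · have hz' := hmax (z i.castSucc) (z i.succ) ⟨hz.1 i, hz.2.1 i,
      ⟨(hz.2.2 _).1, ha.le_of_feasible z hz _⟩, ⟨(hz.2.2 _).1, ha.le_of_feasible z hz _⟩⟩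
    by_cases h₁ : l = i.castSucc
    · rw [h₁, e₁]; exact hz'.1
    by_cases h₂ : l = i.succ
    · rw [h₂, e₂]; exact hz'.2
    rw [e₃ l h₁ h₂]; exact ha.le_of_feasible z hz l
  · rcases hi'.eq_or_lt with rfl | hlt
    · intro k
      rw [e₁, e₂]
      exact ⟨hfeas.2.1 k, fun x hx j => hd.le_comp hfeas hx j k⟩
    · refine (hper i' hlt).mono (e₃ _ ?_ ?_) (hle _)
      · exact (Fin.castSucc_lt_castSucc_iff.2 hlt).ne
      · exact ((Fin.castSucc_lt_castSucc_iff.2 hlt).trans i.castSucc_lt_succ).ne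

lemma foldl_min_spec {β : Type} (f : β → ℝ) (l : List β) (s : ℝ) :
    let v := l.foldl (fun v x => if f x < v then f x else v) s
    v ≤ s ∧ (∀ x ∈ l, v ≤ f x) ∧ (v = s ∨ ∃ x ∈ l, v = f x) := by
  induction l generalizing s with
  | nil => simp
  | cons x xs ih =>
    obtain ⟨h₁, h₂, h₃⟩ := ih (if f x < s then f x else s)
    simp only [List.foldl_cons, List.forall_mem_cons, List.exists_mem_cons_iff]
    refine ⟨?_, ⟨?_, h₂⟩, ?_⟩
    · refine h₁.trans ?_
      split_ifs with h
      exacts [h.le, le_rfl]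
    · refine h₁.trans ?_
      split_ifs with h
      exacts [le_rfl, not_lt.1 h]
    · rcases h₃ with h₃ | h₃
      · split_ifs at h₃ with h
        · exact Or.inr (Or.inl (by simpa [h] using h₃))
        · exact Or.inl (by simpa [h] using h₃)
      · exact Or.inr (Or.inr h₃)

/-- A backward step on the pair `i` keeps all feasible vectors below the bound and makes the
constraints of `i` hold: those of the first kind by definition, those of the second kind because
`i` is persistent. -/
lemma output_backwardStep {d : Addr S → ℝ} (hd : (linearProblem d).Admissible) (i : Fin S.m)
    {a : Fin (S.m + 1) → ℝ} (ha : IsBound (linearProblem d) a)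
    (hper : ∀ i' ≤ i, Persists (linearProblem d) a i')
    (hdone : ∀ i' > i, (∀ j, a i'.castSucc ≤ (linearProblem d).f i' j (a i'.succ)) ∧
      ∀ k, a i'.succ ≤ (linearProblem d).b i' k (a i'.castSucc)) :
    IsBound (linearProblem d) ((backwardStep S a i).output d) ∧
      (∀ i' < i, Persists (linearProblem d) ((backwardStep S a i).output d) i') ∧
      ∀ i' ≥ i, (∀ j, (backwardStep S a i).output d i'.castSucc ≤
          (linearProblem d).f i' j ((backwardStep S a i).output d i'.succ)) ∧
        ∀ k, (backwardStep S a i).output d i'.succ ≤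
          (linearProblem d).b i' k ((backwardStep S a i).output d i'.castSucc) := by
  obtain ⟨v, hv, h₁, h₂, h₃⟩ : ∃ v, (backwardStep S a i).output d = Function.update a i.castSucc v ∧
      v ≤ a i.castSucc ∧ (∀ j, v ≤ (linearProblem d).f i j (a i.succ)) ∧
      (v = a i.castSucc ∨ ∃ j, v = (linearProblem d).f i j (a i.succ)) := by
    have := foldl_min_spec (fun j => (linearProblem d).f i j (a i.succ)) (List.finRange (S.r i))
      (a i.castSucc)
    refine ⟨_, ?_, by simpa using this⟩
    simp only [backwardStep, output_bind, output_forEach, output_input, output_line_at, output_lt,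
      decide_eq_true_eq, output_ite, output_pure, output_store]
    rfl
  rw [hv]
  set a' := Function.update a i.castSucc v with ha'
  have e₁ : a' i.castSucc = v := by simp [ha']
  have e₂ : ∀ l, l ≠ i.castSucc → a' l = a l := fun l h => by simp [ha', h]
  have hle : ∀ l, a' l ≤ a l := by
    intro l
    by_cases h : l = i.castSucc
    · rw [h, e₁]; exact h₁
    · exact (e₂ l h).le
  have hne : i.succ ≠ i.castSucc := i.castSucc_lt_succ.ne'
  have hvnonneg : 0 ≤ v := by
    rcases h₃ with h | ⟨j, h⟩
    · rw [h]; exact ha.nonneg _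
    · rw [h]
      exact (hd.f_pos i j).le.trans
        ((hd.f_increasing i j).monotoneOn (by simp) (ha.nonneg _) (ha.nonneg _))
  refine ⟨⟨fun l => ?_, fun l => (hle l).trans (ha.le_u l), fun z hz l => ?_⟩, fun i' hi' => ?_,
    fun i' hi' => ?_⟩
  · by_cases h : l = i.castSucc
    · rw [h, e₁]; exact hvnonneg
    · rw [e₂ l h]; exact ha.nonneg l
  · by_cases h : l = i.castSucc
    · rw [h, e₁]
      rcases h₃ with h | ⟨j, h⟩
      · rw [h]; exact ha.le_of_feasible z hz _
      · rw [h]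
        exact (hz.1 i j).trans ((hd.f_increasing i j).monotoneOn (hz.2.2 _).1 (ha.nonneg _)
          (ha.le_of_feasible z hz _))
    · rw [e₂ l h]; exact ha.le_of_feasible z hz l
  · exact (hper i' hi'.le).mono (e₂ _ (Fin.castSucc_lt_castSucc_iff.2 hi').ne) (hle _)
  · rcases hi'.eq_or_lt with rfl | hlt
    · rw [e₁, e₂ _ hne]
      refine ⟨h₂, fun k => ?_⟩
      have hp := hper i le_rfl k
      rcases h₃ with h | ⟨j, h⟩
      · rw [h]; exact hp.1
      · rw [h]; exact hp.2 _ ⟨ha.nonneg _, le_rfl⟩ j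
    · have n₁ : i'.castSucc ≠ i.castSucc := (Fin.castSucc_lt_castSucc_iff.2 hlt).ne'
      have n₂ : i'.succ ≠ i.castSucc :=
        ((Fin.castSucc_lt_castSucc_iff.2 hlt).trans i'.castSucc_lt_succ).ne'
      rw [e₂ _ n₁, e₂ _ n₂]
      exact hdone i' hlt

lemma foldl_update_eq {m : ℕ} (f : Fin m → ℝ) (s : Fin m → ℝ) :
    (List.finRange m).foldl (fun a i => Function.update a i (f i)) s = f := by
  have := foldl_finRange_induction (fun k (a : Fin m → ℝ) => ∀ i : Fin m, (i : ℕ) < k → a i = f i)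
    (fun a i => Function.update a i (f i)) s (by simp) fun i a h l hl => by
      by_cases hli : l = i
      · simp [hli]
      · have : (l : ℕ) ≠ i := fun h => hli (Fin.ext h)
        simpa [hli] using h l (by omega)
  exact funext fun i => this i i.2

/-- The algorithm returns the greatest feasible vector. -/
lemma output_forwardBackward {d : Addr S → ℝ} (hd : (linearProblem d).Admissible) :
    (forwardBackward S).output d ∈ (linearProblem d).feasible ∧
      ∀ w ∈ (linearProblem d).feasible, w ≤ (forwardBackward S).output d := by
  simp only [forwardBackward, output_bind, output_forEach, output_input, output_store]
  rw [foldl_update_eq (fun i => d (.u i))]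
  have hu : IsBound (linearProblem d) fun i => d (.u i) :=
    ⟨hd.u_nonneg, fun i => le_rfl, fun w hw i => (hw.2.2 i).2⟩
  have hfwd := foldl_finRange_induction
    (fun k a => IsBound (linearProblem d) a ∧
      ∀ i : Fin S.m, (i : ℕ) < k → Persists (linearProblem d) a i)
    (fun a i => (forwardStep S a i).output d) (fun i => d (.u i)) ⟨hu, by simp⟩
    fun i a h => by
      have := output_forwardStep hd i h.1 h.2
      exact ⟨this.1, fun i' hi' => this.2 i' (Nat.lt_succ_iff.1 hi')⟩
  generalize (List.finRange S.m).foldl _ _ = a at hfwd ⊢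
  have hbwd := foldl_reverse_finRange_induction
    (fun n a => IsBound (linearProblem d) a ∧
      (∀ i : Fin S.m, (i : ℕ) < n → Persists (linearProblem d) a i) ∧
      ∀ i : Fin S.m, n ≤ i → (∀ j, a i.castSucc ≤ (linearProblem d).f i j (a i.succ)) ∧
        ∀ k, a i.succ ≤ (linearProblem d).b i k (a i.castSucc))
    (fun a i => (backwardStep S a i).output d) a
    ⟨hfwd.1, hfwd.2, fun i hi => absurd i.2 (not_lt.2 hi)⟩
    fun i a h => output_backwardStep hd i h.1 (fun i' hi' => h.2.1 i' (Nat.lt_succ_iff.2 hi'))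
      fun i' hi' => h.2.2 i' hi'
  exact ⟨⟨fun i => (hbwd.2.2 i (Nat.zero_le _)).1, fun i => (hbwd.2.2 i (Nat.zero_le _)).2,
    fun i => ⟨hbwd.1.nonneg i, hbwd.1.le_u i⟩⟩, hbwd.1.le_of_feasible⟩

lemma isOptimal_output_forwardBackward {d : Addr S → ℝ} (hd : (linearProblem d).Admissible)
    {g : (Fin (S.m + 1) → ℝ) → ℝ} (hg : AntitoneOn g (Set.Ici 0)) :
    (linearProblem d).IsOptimal g ((forwardBackward S).output d) := by
  obtain ⟨h₁, h₂⟩ := output_forwardBackward hd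
  exact ⟨h₁, fun w hw => hg (fun i => (hw.2.2 i).1) (fun i => (h₁.2.2 i).1) (h₂ w hw)⟩

lemma sum_map_finRange {m : ℕ} (c : Fin m → ℕ) : ((List.finRange m).map c).sum = ∑ i, c i :=
  (Fin.sum_univ_def c).symm

lemma steps_solveSubproblem_le (i : Fin S.m) (U W : ℝ) :
    (solveSubproblem S i U W).steps d ≤ 6007 * (S.t i + S.r i) + 12006 := by
  have hm := steps_megiddoLoop_le d ((lowerLines d i W).length + (upperLines d i).length)
    (lowerLines d i W) (upperLines d i) 0 U
  have h₁ : (lowerLines d i W).length = S.t i + 1 := by simp [lowerLines]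
  have h₂ : (upperLines d i).length = S.r i + 1 := by simp [upperLines]
  simp only [solveSubproblem, steps_bind, steps_number, output_bind, output_number, output_sub,
    output_forEach, output_input, output_pure, foldl_cons_eq, output_div, output_add,
    Int.cast_zero, Int.cast_one, Int.cast_neg, steps_sub]
  rw [← lowerLines, ← upperLines, megiddo]
  have f₁ := steps_forEach_le d (List.finRange (S.t i)) [Line.mk (-1) (0 - W)]
    (fun ls k => do
      let β ← input (.bSlope i k)
      let δ ← input (.bConst i k)
      return Line.mk (← sub (-1) β) (← sub 0 δ) :: ls) (fun _ => 4) (by simp)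
  have f₂ := steps_forEach_le d (List.finRange (S.r i)) [Line.mk (-1 : ℝ) 0]
    (fun ls j => do
      let α ← input (.fSlope i j)
      let γ ← input (.fConst i j)
      return Line.mk (← sub 0 (← div (← add 1 α) α)) (← div γ α) :: ls) (fun _ => 6) (by simp)
  simp only [List.map_const', List.length_finRange, List.sum_replicate, smul_eq_mul] at f₁ f₂
  split <;> simp only [steps_pure, steps_bind, steps_sub] <;> omega

lemma steps_forwardStep_le (i : Fin S.m) (a : Fin (S.m + 1) → ℝ) :
    (forwardStep S a i).steps d ≤ 6007 * (S.t i + S.r i) + 12008 := by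
  have := steps_solveSubproblem_le d i (a i.castSucc) (a i.succ)
  simp only [forwardStep, steps_bind]
  split <;> simp only [steps_pure, steps_bind, steps_store] <;> omega

lemma steps_backwardStep_le (i : Fin S.m) (a : Fin (S.m + 1) → ℝ) :
    (backwardStep S a i).steps d ≤ 6 * S.r i + 1 := by
  have := steps_forEach_le d (List.finRange (S.r i)) (a i.castSucc)
    (fun v j => do
      let α ← input (.fSlope i j)
      let γ ← input (.fConst i j)
      let x ← Line.at ⟨α, γ⟩ (a i.succ)
      if ← lt x v then return x else return v) (fun _ => 5) (by simp)
  simp only [List.map_const', List.length_finRange, List.sum_replicate, smul_eq_mul] at this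
  simp only [backwardStep, steps_bind, steps_store]
  omega

/-- The additive costs per pair, and the costs per variable, are absorbed because each pair has a
constraint and there are at most twice as many variables as pairs. -/
lemma steps_forwardBackward_le (h₁ : 1 ≤ S.m) (h : ∀ i, 1 ≤ S.t i + S.r i) :
    (forwardBackward S).steps d ≤ 20000 * S.numConstraints := by
  have f₁ := fun a => steps_forEach_le d (List.finRange (S.m + 1)) a
    (fun a i => do
      let x ← input (.u i)
      store a i x) (fun _ => 2) (by simp)
  have f₂ := fun a => steps_forEach_le d (List.finRange S.m) a (forwardStep S) _
    fun a i => steps_forwardStep_le d i a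
  have f₃ := fun a => steps_forEach_le d (List.finRange S.m).reverse a (backwardStep S) _
    fun a i => steps_backwardStep_le d i a
  have hm : S.m ≤ S.numConstraints := by
    simpa [Shape.numConstraints] using
      Finset.card_nsmul_le_sum Finset.univ (fun i => S.t i + S.r i) 1 fun i _ => h i
  have hr : ∑ i, S.r i ≤ S.numConstraints := Finset.sum_le_sum fun i _ => Nat.le_add_left _ _
  have hN : ∑ i, S.t i + ∑ i, S.r i = S.numConstraints := Finset.sum_add_distrib.symm
  simp only [List.map_reverse, List.sum_reverse, sum_map_finRange, Finset.sum_add_distrib,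
    ← Finset.mul_sum, Finset.sum_const, Finset.card_univ, Fintype.card_fin, smul_eq_mul]
    at f₁ f₂ f₃
  simp only [forwardBackward, steps_bind, steps_number]
  refine (Nat.add_le_add_left (Nat.add_le_add (f₁ _) (Nat.add_le_add (f₂ _) (f₃ _))) 1).trans ?_
  omega

end ForwardBackward

/-! ### The lower bound -/

section LowerBound

open SpeedPlanning.Comp

variable {S : Shape}

/-- A computation depends only on the numbers that it has read, at most one in each step. -/
lemma exists_addresses_read {ι α : Type} [DecidableEq ι] (d : ι → ℝ) (P : Comp ι ℝ α) :
    ∃ R : Finset ι, R.card ≤ P.steps d ∧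
      ∀ d' : ι → ℝ, (∀ i ∈ R, d' i = d i) → P.output d' = P.output d := by
  induction P with
  | ret a => exact ⟨∅, by simp, fun _ _ => rfl⟩
  | tick k ih =>
    obtain ⟨R, h₁, h₂⟩ := ih
    exact ⟨R, h₁.trans (Nat.le_succ _), h₂⟩
  | read i k ih =>
    obtain ⟨R, h₁, h₂⟩ := ih (d i)
    refine ⟨insert i R, (Finset.card_insert_le i R).trans (Nat.succ_le_succ h₁), fun d' h => ?_⟩
    change (k (d' i)).output d' = (k (d i)).output d
    rw [h i (Finset.mem_insert_self i R)]
    exact h₂ d' fun l hl => h l (Finset.mem_insert_of_mem hl)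
  | const q k ih =>
    obtain ⟨R, h₁, h₂⟩ := ih q
    exact ⟨R, h₁.trans (Nat.le_succ _), h₂⟩
  | arith o x y k ih =>
    obtain ⟨R, h₁, h₂⟩ := ih (o.eval x y)
    exact ⟨R, h₁.trans (Nat.le_succ _), h₂⟩
  | less x y k ih =>
    obtain ⟨R, h₁, h₂⟩ := ih (decide (x < y))
    exact ⟨R, h₁.trans (Nat.le_succ _), h₂⟩

/-- The functional constraints: a pair `i` together with the index of one of its constraints of
either kind. -/
abbrev Constraint (S : Shape) : Type := Σ i : Fin S.m, Fin (S.t i) ⊕ Fin (S.r i)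

lemma card_constraint : Fintype.card (Constraint S) = S.numConstraints := by
  simp [Shape.numConstraints, Constraint]

/-- The functional constraint to which an input number belongs, if any. -/
def Addr.constraint : Addr S → Option (Constraint S)
  | .fSlope i j => some ⟨i, .inr j⟩
  | .fConst i j => some ⟨i, .inr j⟩
  | .bSlope i k => some ⟨i, .inl k⟩
  | .bConst i k => some ⟨i, .inl k⟩
  | .u _ => none

/-- The input in which all bounds are `1`, the constraint `c` (if any) is given by the line
`x ↦ (x + 1) / 4`, and all the others by the line `x ↦ x + 1`. -/
noncomputable def adversary (c : Option (Constraint S)) (a : Addr S) : ℝ := by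
  classical exact if a.constraint.isSome ∧ a.constraint = c then 1 / 4 else 1

lemma adversary_pos (c : Option (Constraint S)) (a : Addr S) : 0 < adversary c a := by
  unfold adversary; split_ifs <;> norm_num

lemma admissible_of_pos {d : Addr S → ℝ} (h : ∀ a, 0 < d a) : (linearProblem d).Admissible := by
  have hconc : ∀ α γ : ℝ, ConcaveOn ℝ (Set.Ici 0) fun x => α * x + γ := fun α γ =>
    ⟨convex_Ici 0, fun x _ y _ s t _ _ hst => by
      have : γ = (s + t) * γ := by rw [hst, one_mul]
      simp only [smul_eq_mul]
      linarith⟩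
  have hmono : ∀ {α : ℝ} (γ : ℝ), 0 < α → StrictMonoOn (fun x => α * x + γ) (Set.Ici 0) :=
    fun γ hα x _ y _ hxy => by
      have := mul_lt_mul_of_pos_left hxy hα
      simp only
      linarith
  exact ⟨fun _ _ => hconc _ _, fun _ _ => hmono _ (h _), fun i j => by simp [linearProblem, h],
    fun _ _ => hconc _ _, fun _ _ => hmono _ (h _), fun i j => by simp [linearProblem, h],
    fun i => (h _).le⟩

lemma one_mem_feasible_adversary : 1 ∈ (linearProblem (adversary (S := S) none)).feasible := by
  refine ⟨fun i j => ?_, fun i k => ?_, fun i => ?_⟩ <;>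
    simp [linearProblem, adversary, Addr.constraint]

lemma one_notMem_feasible_adversary (c : Constraint S) :
    1 ∉ (linearProblem (adversary (some c))).feasible := by
  rintro ⟨h₁, h₂, -⟩
  obtain ⟨i, k | j⟩ := c
  · have := h₂ i k
    simp [linearProblem, adversary, Addr.constraint] at this
    norm_num at this
  · have := h₁ i j
    simp [linearProblem, adversary, Addr.constraint] at this
    norm_num at this

/-- With all constraints slack the only optimal solution is the vector of ones. -/
lemma eq_one_of_isOptimal {g : (Fin (S.m + 1) → ℝ) → ℝ} (hg : StrictAntiOn g (Set.Ici 0))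
    {v : Fin (S.m + 1) → ℝ}
    (hv : (linearProblem (adversary (S := S) none)).IsOptimal g v) : v = 1 := by
  have hle : v ≤ 1 := fun i => by
    have := (hv.1.2.2 i).2
    simpa [linearProblem, adversary, Addr.constraint] using this
  by_contra hne
  have := hg (a := v) (b := 1) (fun i => (hv.1.2.2 i).1) (fun i => zero_le_one)
    (lt_of_le_of_ne hle hne)
  exact (hv.2 1 one_mem_feasible_adversary).not_gt this

/-- A constraint of which no number has been read could have been violated. -/
lemma numConstraints_le_steps {g : (Fin (S.m + 1) → ℝ) → ℝ} (hg : StrictAntiOn g (Set.Ici 0))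
    (P : Comp (Addr S) ℝ (Fin (S.m + 1) → ℝ))
    (hP : ∀ d : Addr S → ℝ, (linearProblem d).Admissible →
      (linearProblem d).IsOptimal g (P.output d)) :
    S.numConstraints ≤ P.steps (adversary none) := by
  classical
  obtain ⟨R, hR, hdep⟩ := exists_addresses_read (adversary none) P
  refine le_trans ?_ hR
  rw [← card_constraint, ← Finset.card_univ, ← Finset.card_image_of_injective _
    (Option.some_injective (Constraint S))]
  refine (Finset.card_le_card ?_).trans (Finset.card_image_le (s := R) (f := Addr.constraint))
  intro o ho
  obtain ⟨c, -, rfl⟩ := Finset.mem_image.1 ho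
  by_contra hc
  have hout := hdep (adversary (some c)) fun a ha => by
    have : a.constraint ≠ some c := fun h => hc (Finset.mem_image.2 ⟨a, ha, h⟩)
    have : a.constraint.isSome → a.constraint ≠ none := fun h h' => by simp [h'] at h
    unfold adversary
    rw [if_neg (by tauto), if_neg (by tauto)]
  have hone := eq_one_of_isOptimal hg (hP _ (admissible_of_pos (adversary_pos none)))
  have hfeas := (hP _ (admissible_of_pos (adversary_pos (some c)))).1
  rw [hout, hone] at hfeas
  exact one_notMem_feasible_adversary c hfeas

end LowerBound

end SpeedPlanning

theorem mainTheorem1 :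
    -- the forward-backward algorithm returns an optimal solution, whatever the objective is
    (∀ (S : SpeedPlanning.Shape) (d : SpeedPlanning.Addr S → ℝ),
      (SpeedPlanning.linearProblem d).Admissible →
      ∀ g : (Fin (S.m + 1) → ℝ) → ℝ, AntitoneOn g (Set.Ici 0) →
        (SpeedPlanning.linearProblem d).IsOptimal g
          ((SpeedPlanning.forwardBackward S).output d)) ∧
    -- it runs in linear time
    (∃ C : ℕ, ∀ (S : SpeedPlanning.Shape), 1 ≤ S.m → (∀ i, 1 ≤ S.t i + S.r i) →
      ∀ d : SpeedPlanning.Addr S → ℝ, (SpeedPlanning.linearProblem d).Admissible →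
        (SpeedPlanning.forwardBackward S).steps d ≤ C * S.numConstraints) ∧
    -- every algorithm that solves the problem, for any one strictly decreasing objective, takes at
    -- least linear time in the worst case, for all numbers of constraints
    (∀ (S : SpeedPlanning.Shape) (g : (Fin (S.m + 1) → ℝ) → ℝ), StrictAntiOn g (Set.Ici 0) →
      ∀ P : SpeedPlanning.Comp (SpeedPlanning.Addr S) ℝ (Fin (S.m + 1) → ℝ),
        (∀ d : SpeedPlanning.Addr S → ℝ, (SpeedPlanning.linearProblem d).Admissible →
          (SpeedPlanning.linearProblem d).IsOptimal g (P.output d)) →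
        ∃ d : SpeedPlanning.Addr S → ℝ, (SpeedPlanning.linearProblem d).Admissible ∧
          S.numConstraints ≤ P.steps d) :=
  ⟨fun _ _ hd _ hg => SpeedPlanning.isOptimal_output_forwardBackward hd hg,
    ⟨20000, fun _ h₁ h d _ => SpeedPlanning.steps_forwardBackward_le d h₁ h⟩,
    fun _ _ hg P hP => ⟨SpeedPlanning.adversary none,
      SpeedPlanning.admissible_of_pos (SpeedPlanning.adversary_pos none),
      SpeedPlanning.numConstraints_le_steps hg P hP⟩⟩
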